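/- **Theorem.** Fix reals $t>1$, $t'\ge t$, integers $k\ge 1$, $h\ge 1$, and a real $\rho$. There is a constant $C=C(t,t',k,h,\rho)$ such that for every finite set $P$ of $n$ points in the plane and every axis-parallel rectangle $R\supseteq P$ in which each side is at most $\rho$ times the other (for instance a square, $\rho=1$), every graph $H$ that the following algorithm (Fast-Sparse-Spanner) can output, whatever its arbitrary choices, is a geometric graph on $P$ (all its edges join points of $P$) with at most $C\,n$ edges. So, for fixed parameters, $H$ has $O(n)$ edges. Here $|uv|$ is the Euclidean distance, the length of a path is the sum of the Euclidean lengths of its edges, and a $t$-path between $u$ and $v$ is a path of length at most $t|uv|$. Ties, and the orders of loops that are not specified, are arbitrary. 1. *Quadtree.* Build a quadtree $T$ with root cell $R$: a cell is split into its four equal-sized quadrants whenever it contains more than $k$ points of $P$ (the root may be split in any case), a non-root cell with at most $k$ points is a leaf, and each point is stored in exactly one leaf whose closed cell contains it. Let $P_\sigma$ be the set of points stored in the leaf $\sigma$; $\sigma$ is non-empty if $P_\sigma\neq\emptyset$. 2. *Local greedy spanners.* Start with the empty graph $H$. For each non-empty leaf $\sigma$ add the graph $H_\sigma$ on $P_\sigma$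 obtained as follows. Start with no edges and $\mathrm{weight}(p,q)=\infty$ for all $p,q$. Go through the pairs $\{p,q\}$ of distinct points in non-decreasing order of $|pq|$; if $\mathrm{weight}(p,q)>t|pq|$, set $\mathrm{weight}(p,x)$ and $\mathrm{weight}(x,p)$, for all $x$, to the current shortest path length between $p$ and $x$, and if still $\mathrm{weight}(p,q)>t|pq|$, add the edge $\{p,q\}$. Let the leader $\ell_\sigma$ be a point of $P_\sigma$ closest to the center of the bounding box of $P_\sigma$. 3. *WSPD-spanner.* Let $S$ be the set of the leaders and $s=4(t'+1)/(t'-1)$. Two point sets are well-separated if there are two congruent disjoint disks, each containing the bounding box of one of the sets, whose distance is at least $s$ times their radius. Build a split tree of $S$ (recursively halve the bounding box of the current point set by a line perpendicular to a longest side, until one point is left). For every inner node of the tree, with children $v,w$, run the procedure FindPairs$(v,w)$: if the point sets of $v$ and $w$ are well-separated, report this pair of sets; otherwise replace $w$ by each of its two children in turn if the longest side of the bounding box of $v$ is at most that of $w$, else replace $v$ by each of its two children in turn, and recurse. For each reported pair $(A,B)$ add to $H$ one edge $\{a,b\}$ with arbitrary $a\in A$, $b\in B$. 4. *Merging neighbors.*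 Let $G_T$ be the graph on all leaves of $T$ (including empty ones) in which two different leaves are adjacent if their closed cells intersect. For each non-empty leaf $\sigma$, and each non-empty neighbor $\sigma'$ of $\sigma$ in $G_T$, if $\sigma,\sigma'$ have not been merged yet, merge them: let $L$ be the list of the pairs $(u,v)\in P_\sigma\times P_{\sigma'}$, without those pairs with $t|u\ell_\sigma|+|\ell_\sigma\ell_{\sigma'}|+t|\ell_{\sigma'}v|\le t|uv|$ if the edge $\{\ell_\sigma,\ell_{\sigma'}\}$ is in $H$; sort $L$ by $|uv|$; start with an empty set of bridges, and *treat* each $(u,v)\in L$ in this order. *Treating* $(u,v)$: if there is a bridge, a recorded path from some $x$ to some $y$ of length $\lambda$, with $t|ux|+\lambda+t|yv|\le t|uv|$, do nothing. Otherwise, run the greedy path search (from $u$, repeatedly move from the current vertex $y$ to an unvisited neighbor $x$ in $H$ minimizing $|yx|+|xv|$, until $v$ is reached or no unvisited neighbor exists); if it returns a $t$-path, record that path as a bridge; otherwise, if a shortest path between $u$ and $v$ in $H$ is a $t$-path, record it as a bridge; otherwise add the edge $\{u,v\}$ to $H$ and record it as a bridge. 5. *Merging leaves at 2 to $h$ hops.*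 For $i=2,\dots,h$, for each non-empty leaf $\sigma$ and each non-empty leaf $\sigma'$ at graph distance exactly $i$ from $\sigma$ in $G_T$, if $\sigma,\sigma'$ have not been merged yet, merge them in the lighter way: start with the edge $\{\ell_\sigma,\ell_{\sigma'}\}$ as the only bridge if it is in $H$, and with no bridge otherwise; sort $P_\sigma$ by the distance from $\ell_{\sigma'}$ and $P_{\sigma'}$ by the distance from $\ell_\sigma$; for each $u\in P_\sigma$ in this order and each $v\in P_{\sigma'}$ in this order, treat $(u,v)$ as in step 4. The graph $H$ obtained after step 5 is the output. -/

import Mathlib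

namespace FastSpanner

/-- The Euclidean plane. -/
abbrev Plane : Type := EuclideanSpace ℝ (Fin 2)

section Loops

/-- `Loop step L s₀ s₁`: executing the (possibly nondeterministic) body `step a` once for every
entry `a` of the list `L`, in this order, can turn the state `s₀` into the state `s₁`. -/
inductive Loop {α σ : Type} (step : α → σ → σ → Prop) : List α → σ → σ → Prop
  | nil (s : σ) : Loop step [] s s
  | cons {a : α} {L : List α} {s₀ s₁ s₂ : σ} :
      step a s₀ s₁ → Loop step L s₁ s₂ → Loop step (a :: L) s₀ s₂

/-- "for each `a ∈ S` do `step a`", the elements of `S` being taken once each, in any order. -/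
def ForEach {α σ : Type} (S : Set α) (step : α → σ → σ → Prop) (s₀ s₁ : σ) : Prop :=
  ∃ L : List α, L.Nodup ∧ (∀ a, a ∈ L ↔ a ∈ S) ∧ Loop step L s₀ s₁

end Loops

section Geometry

/-- A closed axis-parallel rectangle, given by its lower left and upper right corners. -/
structure Box where
  lo : Fin 2 → ℝ
  hi : Fin 2 → ℝ

def Box.toSet (B : Box) : Set Plane := {p | ∀ i, B.lo i ≤ p i ∧ p i ≤ B.hi i}

noncomputable def Box.side (B : Box) (i : Fin 2) : ℝ := B.hi i - B.lo i

noncomputable def Box.mid (B : Box) (i : Fin 2) : ℝ := (B.lo i + B.hi i) / 2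

noncomputable def Box.center (B : Box) : Plane := WithLp.toLp 2 B.mid

/-- The length of a longest side. -/
noncomputable def Box.maxSide (B : Box) : ℝ := max (B.side 0) (B.side 1)

/-- The four equal-sized closed quadrants; `b i` tells whether the upper half is taken in
direction `i`. -/
noncomputable def Box.quadrant (B : Box) (b : Fin 2 → Bool) : Box where
  lo := fun i => if b i then B.mid i else B.lo i
  hi := fun i => if b i then B.hi i else B.mid i

/-- The bounding box of a nonempty finite point set. -/
noncomputable def bbox (Q : Finset Plane) : Box where
  lo := fun i => sInf ((fun p : Plane => p i) '' (Q : Set Plane))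
  hi := fun i => sSup ((fun p : Plane => p i) '' (Q : Set Plane))

end Geometry

section Paths

/-- The Euclidean length of a walk in a geometric graph. -/
noncomputable def walkLength {H : SimpleGraph Plane} {u v : Plane} (p : H.Walk u v) : ℝ :=
  (p.darts.map fun d => dist d.fst d.snd).sum

/-- `p` is a `t`-path for its end points. -/
def IsTPath (t : ℝ) {H : SimpleGraph Plane} {u v : Plane} (p : H.Walk u v) : Prop :=
  walkLength p ≤ t * dist u v

def IsShortest {H : SimpleGraph Plane} {u v : Plane} (p : H.Walk u v) : Prop :=
  ∀ q : H.Walk u v, walkLength p ≤ walkLength q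

/-- The length of a shortest path in `H` between `u` and `v`, `∞` if there is no path. -/
noncomputable def graphDist (H : SimpleGraph Plane) (u v : Plane) : ENNReal :=
  ⨅ p : H.Walk u v, ENNReal.ofReal (walkLength p)

/-- `x` is an unvisited neighbor of `y` that minimizes `|yx| + |xv|`. -/
def IsGreedyNext (H : SimpleGraph Plane) (v : Plane) (visited : Set Plane) (y x : Plane) : Prop :=
  (H.Adj y x ∧ x ∉ visited) ∧
    ∀ z, H.Adj y z → z ∉ visited → dist y x + dist x v ≤ dist y z + dist z v

/-- `GreedyPath H v visited y r`: the loop of the greedy path search with target `v`, standing at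
`y ≠ v` with the given set of visited vertices, can return `r` (`none`: no path found). -/
inductive GreedyPath (H : SimpleGraph Plane) (v : Plane) :
    Set Plane → (y : Plane) → Option (H.Walk y v) → Prop
  | stuck {visited : Set Plane} {y : Plane} :
      (∀ x, H.Adj y x → x ∈ visited) → GreedyPath H v visited y none
  | arrive {visited : Set Plane} {y : Plane} (hadj : H.Adj y v) :
      IsGreedyNext H v visited y v →
      GreedyPath H v visited y (some (SimpleGraph.Walk.cons hadj SimpleGraph.Walk.nil))
  | move {visited : Set Plane} {y x : Plane} {r : Option (H.Walk x v)} (hadj : H.Adj y x) :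
      x ≠ v → IsGreedyNext H v visited y x → GreedyPath H v (insert x visited) x r →
      GreedyPath H v visited y (r.map (SimpleGraph.Walk.cons hadj))

end Paths

section LocalGreedy

/-- The state of the local greedy algorithm: the graph built so far and the matrix `weight`. -/
structure FGState where
  graph : SimpleGraph Plane
  weight : Plane → Plane → ENNReal

open scoped Classical in
/-- The weight matrix after a single-source shortest path computation from `p`. -/
noncomputable def FGState.refresh (s : FGState) (p : Plane) : Plane → Plane → ENNReal :=
  fun x y => if x = p then graphDist s.graph p y
    else if y = p then graphDist s.graph p x else s.weight x y

open scoped Classical in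
/-- The treatment of one pair of points. -/
noncomputable def FGState.step (t : ℝ) (s : FGState) (e : Plane × Plane) : FGState :=
  if ENNReal.ofReal (t * dist e.1 e.2) < s.weight e.1 e.2 then
    if ENNReal.ofReal (t * dist e.1 e.2) < s.refresh e.1 e.1 e.2 then
      ⟨s.graph ⊔ SimpleGraph.edge e.1 e.2, s.refresh e.1⟩
    else ⟨s.graph, s.refresh e.1⟩
  else s

/-- `H` is an output of the greedy spanner algorithm with a weight matrix, run on the point set
`Q` with parameter `t`: the list `L` contains every pair of distinct points once, in
non-decreasing order of the distances. -/
def IsFGGreedy (t : ℝ) (Q : Finset Plane) (H : SimpleGraph Plane) : Prop :=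
  ∃ L : List (Plane × Plane),
    (L.map fun e => s(e.1, e.2)).Nodup ∧
    (∀ u v, s(u, v) ∈ (L.map fun e => s(e.1, e.2)) ↔ u ∈ Q ∧ v ∈ Q ∧ u ≠ v) ∧
    (L.Pairwise fun e f => dist e.1 e.2 ≤ dist f.1 f.2) ∧
    H = (L.foldl (FGState.step t) ⟨⊥, fun _ _ => ⊤⟩).graph

end LocalGreedy

section WSPD

/-- Two congruent disjoint closed disks contain the bounding boxes of `A` and of `B`, and the
distance between the disks is at least `s` times their radius. -/
def WellSeparated (s : ℝ) (A B : Finset Plane) : Prop :=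
  ∃ (a b : Plane) (r : ℝ), 0 ≤ r ∧
    (bbox A).toSet ⊆ Metric.closedBall a r ∧ (bbox B).toSet ⊆ Metric.closedBall b r ∧
    2 * r < dist a b ∧ s * r ≤ dist a b - 2 * r

/-- Binary trees whose leaves store one point each. -/
inductive SplitTree where
  | leaf (p : Plane)
  | node (l r : SplitTree)

open scoped Classical in
noncomputable def SplitTree.pts : SplitTree → Finset Plane
  | .leaf p => {p}
  | .node l r => l.pts ∪ r.pts

/-- The split trees: at every inner node the bounding box of the points stored below it is halved
by a line perpendicular to a longest side, and the points are distributed to the two children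
accordingly (points on the line may go to either child). -/
def SplitTree.Valid : SplitTree → Prop
  | .leaf _ => True
  | .node l r => Disjoint l.pts r.pts ∧
      (∃ i : Fin 2, (∀ j, (bbox (SplitTree.node l r).pts).side j ≤
            (bbox (SplitTree.node l r).pts).side i) ∧
        (∀ p ∈ l.pts, p i ≤ (bbox (SplitTree.node l r).pts).mid i) ∧
        (∀ p ∈ r.pts, (bbox (SplitTree.node l r).pts).mid i ≤ p i)) ∧
      l.Valid ∧ r.Valid

/-- The recursive search for well-separated pairs below two disjoint nodes of a split tree. -/
inductive FindPairs (s : ℝ) :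
    SplitTree → SplitTree → List (Finset Plane × Finset Plane) → Prop
  | separated {v w : SplitTree} :
      WellSeparated s v.pts w.pts → FindPairs s v w [(v.pts, w.pts)]
  | splitRight {v l r : SplitTree} {L₁ L₂ : List (Finset Plane × Finset Plane)} :
      ¬ WellSeparated s v.pts (SplitTree.node l r).pts →
      (bbox v.pts).maxSide ≤ (bbox (SplitTree.node l r).pts).maxSide →
      FindPairs s v l L₁ → FindPairs s v r L₂ → FindPairs s v (SplitTree.node l r) (L₁ ++ L₂)
  | splitLeft {l r w : SplitTree} {L₁ L₂ : List (Finset Plane × Finset Plane)} :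
      ¬ WellSeparated s (SplitTree.node l r).pts w.pts →
      (bbox w.pts).maxSide < (bbox (SplitTree.node l r).pts).maxSide →
      FindPairs s l w L₁ → FindPairs s r w L₂ → FindPairs s (SplitTree.node l r) w (L₁ ++ L₂)

/-- The well-separated pair decomposition computed from a split tree: the pairs found below the
two children of every inner node. -/
inductive ComputeWSPD (s : ℝ) : SplitTree → List (Finset Plane × Finset Plane) → Prop
  | leaf (p : Plane) : ComputeWSPD s (SplitTree.leaf p) []
  | node {l r : SplitTree} {L₀ L₁ L₂ : List (Finset Plane × Finset Plane)} :
      FindPairs s l r L₀ → ComputeWSPD s l L₁ → ComputeWSPD s r L₂ →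
      ComputeWSPD s (SplitTree.node l r) (L₀ ++ L₁ ++ L₂)

/-- `W` is a WSPD `t`-spanner on `S`: one edge, with arbitrarily chosen end points, for every pair
of the well-separated pair decomposition with separation ratio `4 (t + 1) / (t - 1)`. -/
def IsWSPDSpanner (t : ℝ) (S : Finset Plane) (W : SimpleGraph Plane) : Prop :=
  (S = ∅ ∧ W = ⊥) ∨
  ∃ T : SplitTree, T.Valid ∧ T.pts = S ∧
    ∃ L : List (Finset Plane × Finset Plane), ComputeWSPD (4 * (t + 1) / (t - 1)) T L ∧
      ∃ a b : Finset Plane × Finset Plane → Plane,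
        (∀ A ∈ L, a A ∈ A.1 ∧ b A ∈ A.2) ∧
        W = SimpleGraph.fromEdgeSet {e | ∃ A ∈ L, e = s(a A, b A)}

end WSPD

section Quadtree

/-- A leaf of a quadtree: its cell and the set of the points stored in it. -/
structure Leaf where
  box : Box
  pts : Finset Plane

/-- Quadtrees: `4`-ary trees whose leaves store finite point sets. -/
inductive QuadTree where
  | leaf (Q : Finset Plane)
  | node (child : (Fin 2 → Bool) → QuadTree)

open scoped Classical in
/-- All points stored in the tree. -/
noncomputable def QuadTree.pts : QuadTree → Finset Plane
  | .leaf Q => Q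
  | .node child => Finset.univ.biUnion fun b => (child b).pts

/-- The leaves of a quadtree whose root has the cell `B`. -/
def QuadTree.leaves : QuadTree → Box → Set Leaf
  | .leaf Q, B => {⟨B, Q⟩}
  | .node child, B => ⋃ b, (child b).leaves (B.quadrant b)

/-- The subtrees below the root: a node is subdivided if and only if more than `k` points are
stored below it, every point lies in the (closed) cell of its leaf, and no point is stored twice. -/
def QuadTree.ValidBelow (k : ℕ) : QuadTree → Box → Prop
  | .leaf Q, B => Q.card ≤ k ∧ (Q : Set Plane) ⊆ B.toSet
  | .node child, B => k < (QuadTree.node child).pts.card ∧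
      (∀ b c, b ≠ c → Disjoint (child b).pts (child c).pts) ∧
      ∀ b, (child b).ValidBelow k (B.quadrant b)

/-- The quadtrees with root cell `B`. The root may be subdivided even if it contains at most `k`
points. -/
def QuadTree.Valid (k : ℕ) : QuadTree → Box → Prop
  | .leaf Q, B => Q.card ≤ k ∧ (Q : Set Plane) ⊆ B.toSet
  | .node child, B =>
      (∀ b c, b ≠ c → Disjoint (child b).pts (child c).pts) ∧
      ∀ b, (child b).ValidBelow k (B.quadrant b)

def QuadTree.nonemptyLeaves (T : QuadTree) (B : Box) : Set Leaf :=
  {σ | σ ∈ T.leaves B ∧ σ.pts.Nonempty}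

/-- The dual graph on the leaves (empty ones included): two different leaves are neighbors if
their closed cells intersect. -/
def QuadTree.dual (T : QuadTree) (B : Box) : SimpleGraph Leaf where
  Adj σ τ := σ ≠ τ ∧ σ ∈ T.leaves B ∧ τ ∈ T.leaves B ∧ (σ.box.toSet ∩ τ.box.toSet).Nonempty
  symm := ⟨fun σ τ h => ⟨h.1.symm, h.2.2.1, h.2.1, by rw [Set.inter_comm]; exact h.2.2.2⟩⟩
  loopless := ⟨fun _ h => h.1 rfl⟩

/-- `l` is a point of `Q` closest to the center of the bounding box of `Q`. -/
def IsLeader (Q : Finset Plane) (l : Plane) : Prop :=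
  l ∈ Q ∧ ∀ p ∈ Q, dist l (bbox Q).center ≤ dist p (bbox Q).center

end Quadtree

section Merge

/-- The state of a merging: the graph built so far, and the bridges found so far, each recorded
as its two end points and its length. -/
structure MergeState where
  graph : SimpleGraph Plane
  bridges : Set (Plane × Plane × ℝ)

/-- Some bridge from `x` to `y` satisfies `(t |ux| + |x ⇝ y| + t |yv|) / |uv| ≤ t`. -/
def HasBridge (t : ℝ) (bridges : Set (Plane × Plane × ℝ)) (u v : Plane) : Prop :=
  ∃ (x y : Plane) (len : ℝ), (x, y, len) ∈ bridges ∧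
    (t * dist u x + len + t * dist y v) / dist u v ≤ t

/-- The treatment of one pair `(u, v)` in a merging: use an earlier bridge, or a `t`-path found by
the greedy path search, or a shortest path if that is a `t`-path (that is, if there is any
`t`-path), or else place the edge `{u, v}`. -/
inductive MergePair (t : ℝ) : Plane × Plane → MergeState → MergeState → Prop
  | bridged {u v : Plane} {s : MergeState} :
      HasBridge t s.bridges u v → MergePair t (u, v) s s
  | greedy {u v : Plane} {s : MergeState} {p : s.graph.Walk u v} :
      ¬ HasBridge t s.bridges u v →
      GreedyPath s.graph v {u} u (some p) → IsTPath t p →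
      MergePair t (u, v) s ⟨s.graph, insert (u, v, walkLength p) s.bridges⟩
  | shortest {u v : Plane} {s : MergeState} {r : Option (s.graph.Walk u v)}
      {q : s.graph.Walk u v} :
      ¬ HasBridge t s.bridges u v →
      GreedyPath s.graph v {u} u r → (∀ p, r = some p → ¬ IsTPath t p) →
      IsShortest q → IsTPath t q →
      MergePair t (u, v) s ⟨s.graph, insert (u, v, walkLength q) s.bridges⟩
  | place {u v : Plane} {s : MergeState} {r : Option (s.graph.Walk u v)} :
      ¬ HasBridge t s.bridges u v →
      GreedyPath s.graph v {u} u r → (∀ p, r = some p → ¬ IsTPath t p) →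
      (∀ q : s.graph.Walk u v, ¬ IsTPath t q) →
      MergePair t (u, v) s
        ⟨s.graph ⊔ SimpleGraph.edge u v, insert (u, v, dist u v) s.bridges⟩

/-- Merging of neighboring leaves with point sets `A`, `B` and leaders `a`, `b`: pairs served by
an edge `{a, b}` of `H` are pruned, the others are treated in the order of their distances. -/
def GreedyMerge (t : ℝ) (A B : Finset Plane) (a b : Plane) (H H' : SimpleGraph Plane) : Prop :=
  ∃ L : List (Plane × Plane), L.Nodup ∧
    (∀ u v, (u, v) ∈ L ↔ u ∈ A ∧ v ∈ B ∧
      ¬ (H.Adj a b ∧ (t * dist u a + dist a b + t * dist b v) / dist u v ≤ t)) ∧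
    (L.Pairwise fun e f => dist e.1 e.2 ≤ dist f.1 f.2) ∧
    ∃ s : MergeState, Loop (MergePair t) L ⟨H, ∅⟩ s ∧ H' = s.graph

/-- The lighter merging of leaves with point sets `A`, `B` and leaders `a`, `b`: `A` and `B` are
sorted by the distances from the leader of the other leaf, and all pairs are treated in two nested
loops. -/
def GreedyMergeLight (t : ℝ) (A B : Finset Plane) (a b : Plane) (H H' : SimpleGraph Plane) :
    Prop :=
  ∃ LA LB : List Plane, LA.Nodup ∧ (∀ u, u ∈ LA ↔ u ∈ A) ∧ LB.Nodup ∧ (∀ v, v ∈ LB ↔ v ∈ B) ∧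
    (LA.Pairwise fun u u' => dist u b ≤ dist u' b) ∧
    (LB.Pairwise fun v v' => dist v a ≤ dist v' a) ∧
    ∃ s : MergeState,
      Loop (fun u s₀ s₁ => Loop (fun v => MergePair t (u, v)) LB s₀ s₁) LA
        ⟨H, {e | H.Adj a b ∧ e = (a, b, dist a b)}⟩ s ∧
      H' = s.graph

end Merge

section Main

/-- The state of the merging phase: the graph built so far and the pairs of leaves merged so
far. -/
structure SpannerState where
  graph : SimpleGraph Plane
  merged : Set (Sym2 Leaf)

/-- Merge two leaves with the procedure `merge`, unless they have been merged already. -/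
def MergeLeaves
    (merge : Finset Plane → Finset Plane → Plane → Plane →
      SimpleGraph Plane → SimpleGraph Plane → Prop)
    (leader : Leaf → Plane) (σ τ : Leaf) (s₀ s₁ : SpannerState) : Prop :=
  (s(σ, τ) ∈ s₀.merged ∧ s₁ = s₀) ∨
  (s(σ, τ) ∉ s₀.merged ∧ s₁.merged = insert s(σ, τ) s₀.merged ∧
    merge σ.pts τ.pts (leader σ) (leader τ) s₀.graph s₁.graph)

/-- `H` is an output of the algorithm Fast-Sparse-Spanner on the point set `P`, with parameters
`t`, `t'`, `k`, `h`, for a quadtree with root cell `R`. -/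
def IsFastSparseSpanner (t t' : ℝ) (k h : ℕ) (R : Box) (P : Finset Plane)
    (H : SimpleGraph Plane) : Prop :=
  ∃ T : QuadTree, T.Valid k R ∧ T.pts = P ∧
  ∃ leader : Leaf → Plane, (∀ σ ∈ T.nonemptyLeaves R, IsLeader σ.pts (leader σ)) ∧
  ∃ H₂ : SimpleGraph Plane,
    ForEach (T.nonemptyLeaves R)
      (fun σ G G' => ∃ Hσ, IsFGGreedy t σ.pts Hσ ∧ G' = G ⊔ Hσ) ⊥ H₂ ∧
  ∃ S : Finset Plane, (S : Set Plane) = leader '' T.nonemptyLeaves R ∧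
  ∃ W : SimpleGraph Plane, IsWSPDSpanner t' S W ∧
  ∃ s₄ s₅ : SpannerState,
    ForEach (T.nonemptyLeaves R)
      (fun σ => ForEach {τ | τ ∈ T.nonemptyLeaves R ∧ (T.dual R).Adj σ τ}
        (fun τ => MergeLeaves (GreedyMerge t) leader σ τ))
      ⟨H₂ ⊔ W, ∅⟩ s₄ ∧
    Loop
      (fun i => ForEach (T.nonemptyLeaves R)
        (fun σ => ForEach {τ | τ ∈ T.nonemptyLeaves R ∧ (T.dual R).dist σ τ = i}
          (fun τ => MergeLeaves (GreedyMergeLight t) leader σ τ)))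
      (List.range' 2 (h - 1)) s₄ s₅ ∧
    H = s₅.graph

end Main

end FastSpanner

open FastSpanner

/-!
The edges of the output are of three kinds. The local spanners contribute at most `k` edges per
point. The spanner on the leaders contributes one edge per pair of a well-separated pair
decomposition, whose size is linear. All other edges are placed by the merging phases, and about
these only one fact is used: an edge `{u, v}` is placed only if the current graph has no `t`-path
between `u` and `v` (`IsGreedyExtension`). Neither the order of the mergings nor the hop distances
matter.

To count the merging edges, take a well-separated pair decomposition of the whole point set with a
large separation ratio, and consider an edge between the sets of a pair at distance `D`. Each of
its ends lies in a leaf cell that is either *small* or *large* compared to `ε D`. Two points of one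
set of the pair are close to each other at scale `D`, and they are joined by a short walk of the
graph built before the merging phases in the following two cases: if both of their cells are small,
through the leaders of the cells, and if they lie in the same leaf, through the local spanner. Large
cells that meet a much smaller disk contain a point of a lattice block of bounded size, so a bounded
number of labels (small, or the index of a lattice point) decides which case applies
(`exists_hasCellLabel`, `HasCellLabel.hasWalk`). If two merging edges belonged to the same
pair and had the same labels at both ends, the one placed first would give a path between the ends
of the other one, of length less than `t` times their distance (`exists_labels`). Hence the number
of merging edges is at most a constant times the size of the decomposition
(`IsGreedyExtension.exists_finset`).

The decomposition has linear size (`ComputeWSPD.card_le`) by the argument of Callahan and Kosaraju.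
Every node of the split tree is given a region, by cutting the region of its parent along the
halving line. Its sides are at least half as long as the bounding box of the parent's points. A
reported pair is charged to the node `p` that was split last before it was reported. The
other node of the pair is no larger than `p`, has a parent no smaller than `p`, and is close to `p`,
so that its region contains a point of a lattice block of bounded size around `p`. The half-open
regions of nodes that are not nested are disjoint, which makes the charging injective.
-/

namespace FastSpanner

/-! ### Boxes and bounding boxes -/

lemma abs_sub_le_dist (x y : Plane) (i : Fin 2) : |x i - y i| ≤ dist x y := by
  rw [dist_eq_norm]
  simpa using PiLp.norm_apply_le (x - y) i

lemma dist_le_abs_add_abs (x y : Plane) : dist x y ≤ |x 0 - y 0| + |x 1 - y 1| := by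
  rw [EuclideanSpace.dist_eq, Real.sqrt_le_left (by positivity)]
  simp only [Fin.sum_univ_two, Real.dist_eq]
  nlinarith [abs_nonneg (x 0 - y 0), abs_nonneg (x 1 - y 1)]

lemma dist_le_of_coord {x y : Plane} {c : ℝ} (h : ∀ i, |x i - y i| ≤ c) : dist x y ≤ 2 * c := by
  linarith [dist_le_abs_add_abs x y, h 0, h 1]

lemma Box.side_le_maxSide (B : Box) (i : Fin 2) : B.side i ≤ B.maxSide := by
  fin_cases i
  · exact le_max_left _ _
  · exact le_max_right _ _

lemma Box.maxSide_le {B : Box} {c : ℝ} (h : ∀ i, B.side i ≤ c) : B.maxSide ≤ c :=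
  max_le (h 0) (h 1)

lemma Box.maxSide_eq_of_forall_le {B : Box} {i : Fin 2} (h : ∀ j, B.side j ≤ B.side i) :
    B.side i = B.maxSide :=
  le_antisymm (B.side_le_maxSide i) (Box.maxSide_le h)

lemma bbox_lo_le {Q : Finset Plane} {p : Plane} (hp : p ∈ Q) (i : Fin 2) :
    (bbox Q).lo i ≤ p i :=
  csInf_le (Q.finite_toSet.image _).bddBelow ⟨p, hp, rfl⟩

lemma le_bbox_hi {Q : Finset Plane} {p : Plane} (hp : p ∈ Q) (i : Fin 2) :
    p i ≤ (bbox Q).hi i :=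
  le_csSup (Q.finite_toSet.image _).bddAbove ⟨p, hp, rfl⟩

lemma mem_bbox {Q : Finset Plane} {p : Plane} (hp : p ∈ Q) : p ∈ (bbox Q).toSet :=
  fun i => ⟨bbox_lo_le hp i, le_bbox_hi hp i⟩

lemma exists_eq_bbox_lo {Q : Finset Plane} (hQ : Q.Nonempty) (i : Fin 2) :
    ∃ p ∈ Q, p i = (bbox Q).lo i := by
  have hne : ((fun p : Plane => p i) '' (Q : Set Plane)).Nonempty := hQ.to_set.image _
  obtain ⟨p, hp, h⟩ := hne.csInf_mem (Q.finite_toSet.image _)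
  exact ⟨p, hp, h⟩

lemma exists_eq_bbox_hi {Q : Finset Plane} (hQ : Q.Nonempty) (i : Fin 2) :
    ∃ p ∈ Q, p i = (bbox Q).hi i := by
  have hne : ((fun p : Plane => p i) '' (Q : Set Plane)).Nonempty := hQ.to_set.image _
  obtain ⟨p, hp, h⟩ := hne.csSup_mem (Q.finite_toSet.image _)
  exact ⟨p, hp, h⟩

lemma bbox_maxSide_mono {Q Q' : Finset Plane} (hQ : Q.Nonempty) (h : Q ⊆ Q') :
    (bbox Q).maxSide ≤ (bbox Q').maxSide := by
  refine Box.maxSide_le fun i => le_trans ?_ ((bbox Q').side_le_maxSide i)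
  obtain ⟨p, hp, hp'⟩ := exists_eq_bbox_lo hQ i
  obtain ⟨q, hq, hq'⟩ := exists_eq_bbox_hi hQ i
  have h1 := bbox_lo_le (h hp) i
  have h2 := le_bbox_hi (h hq) i
  unfold Box.side
  linarith

lemma bbox_maxSide_nonneg {Q : Finset Plane} (hQ : Q.Nonempty) : 0 ≤ (bbox Q).maxSide := by
  obtain ⟨p, hp⟩ := hQ
  have h1 := bbox_lo_le hp 0
  have h2 := le_bbox_hi hp 0
  have h3 := (bbox Q).side_le_maxSide 0
  unfold Box.side at h3
  linarith

lemma bbox_maxSide_pos {Q : Finset Plane} {p q : Plane} (hp : p ∈ Q) (hq : q ∈ Q) (hpq : p ≠ q) :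
    0 < (bbox Q).maxSide := by
  by_contra! h
  refine hpq (PiLp.ext fun i => ?_)
  have h3 := (bbox Q).side_le_maxSide i
  have := bbox_lo_le hp i
  have := le_bbox_hi hp i
  have := bbox_lo_le hq i
  have := le_bbox_hi hq i
  unfold Box.side at h3
  linarith

/-- The box without its upper and right sides. In contrast to closed boxes, the half-open boxes
of the parts of a subdivision are disjoint. -/
def Box.halfOpen (B : Box) : Set (Fin 2 → ℝ) := {c | ∀ i, B.lo i ≤ c i ∧ c i < B.hi i}

/-- A half-open interval longer than the spacing `δ` contains, within distance `δ` of any point of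
its closure, a point of the lattice `c + δ ℤ`. -/
lemma exists_lattice_mem_Ico {lo hi y c δ ρ : ℝ} (hδ : 0 < δ) (hlen : δ < hi - lo) (h1 : lo ≤ y)
    (h2 : y ≤ hi) {N : ℤ} (hN : ρ + δ ≤ N * δ) (hy : |y - c| ≤ ρ) :
    ∃ j ∈ Finset.Icc (-N) N, lo ≤ c + j * δ ∧ c + j * δ < hi := by
  set z := max lo (y - δ) with hz
  have hz1 : lo ≤ z := le_max_left _ _
  have hz2 : y - δ ≤ z := le_max_right _ _
  have hz3 : z ≤ y := max_le h1 (by linarith)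
  have hz4 : z + δ ≤ hi := by
    rw [hz, max_add]
    exact max_le (by linarith) (by linarith)
  have h3 : (z - c) / δ ≤ ⌈(z - c) / δ⌉ := Int.le_ceil _
  have h4 : (⌈(z - c) / δ⌉ : ℝ) < (z - c) / δ + 1 := Int.ceil_lt_add_one _
  rw [div_le_iff₀ hδ] at h3
  have h5 : (⌈(z - c) / δ⌉ : ℝ) * δ < z - c + δ := by
    have := mul_lt_mul_of_pos_right h4 hδ
    rwa [add_mul, div_mul_cancel₀ _ hδ.ne', one_mul] at this
  rw [abs_le] at hy
  refine ⟨⌈(z - c) / δ⌉, Finset.mem_Icc.2 ⟨?_, ?_⟩, by linarith, ?_⟩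
  · have : -(N : ℝ) ≤ (⌈(z - c) / δ⌉ : ℝ) := by
      refine le_of_mul_le_mul_right ?_ hδ
      linarith
    exact_mod_cast this
  · have : (⌈(z - c) / δ⌉ : ℝ) < N + 1 := by
      refine lt_of_mul_lt_mul_right ?_ hδ.le
      linarith
    exact Int.lt_add_one_iff.1 (by exact_mod_cast this)
  · -- `c + ⌈(z - c) / δ⌉ δ < z + δ ≤ hi`
    linarith

/-- The points of the lattice of spacing `δ` around `c`. -/
def latticePoint (c : Fin 2 → ℝ) (δ : ℝ) (j : Fin 2 → ℤ) : Fin 2 → ℝ := fun i => c i + j i * δ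

/-- The square block of `(2 N + 1)²` lattice indices. -/
noncomputable def latticeBlock (N : ℤ) : Finset (Fin 2 → ℤ) :=
  Fintype.piFinset fun _ => Finset.Icc (-N) N

lemma exists_latticePoint_mem_halfOpen {B : Box} {y c : Plane} {δ ρ : ℝ} (hδ : 0 < δ)
    (hside : ∀ i, δ < B.side i) (hy : y ∈ B.toSet) {N : ℤ} (hN : ρ + δ ≤ N * δ)
    (hc : ∀ i, |y i - c i| ≤ ρ) :
    ∃ j ∈ latticeBlock N, latticePoint c δ j ∈ B.halfOpen := by
  choose j hj hj' using fun i =>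
    exists_lattice_mem_Ico hδ (hside i) (hy i).1 (hy i).2 hN (hc i)
  exact ⟨j, by simpa [latticeBlock, Fintype.mem_piFinset] using hj, hj'⟩

/-! ### Counting through labels -/

/-- If every element of a finite set carries a label and no label is carried by two elements, then
there are at most as many elements as labels. -/
lemma card_le_card_of_labels {α β : Type*} {S : Finset α} {Λ : Finset β} (R : α → β → Prop)
    (h1 : ∀ x ∈ S, ∃ l ∈ Λ, R x l) (h2 : ∀ x ∈ S, ∀ y ∈ S, ∀ l ∈ Λ, R x l → R y l → x = y) :
    S.card ≤ Λ.card := by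
  choose f hf hf' using h1
  rw [← Finset.card_attach]
  refine Finset.card_le_card_of_injOn (fun x => f x.1 x.2) (fun x _ => hf x.1 x.2)
    fun x _ y _ hxy => Subtype.ext ?_
  have hxy : f x.1 x.2 = f y.1 y.2 := hxy
  exact h2 x.1 x.2 y.1 y.2 _ (hf _ _) (hf' _ _) (by rw [hxy]; exact hf' _ _)

/-! ### Lengths of walks -/

/-- There is a walk of length at most `c` from `u` to `v` in `G`. -/
def HasWalk (G : SimpleGraph Plane) (c : ℝ) (u v : Plane) : Prop :=
  ∃ p : G.Walk u v, walkLength p ≤ c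

lemma walkLength_append {G : SimpleGraph Plane} {u v w : Plane} (p : G.Walk u v) (q : G.Walk v w) :
    walkLength (p.append q) = walkLength p + walkLength q := by
  simp [walkLength]

lemma walkLength_reverse {G : SimpleGraph Plane} {u v : Plane} (p : G.Walk u v) :
    walkLength p.reverse = walkLength p := by
  simp only [walkLength, SimpleGraph.Walk.darts_reverse, List.map_reverse, List.map_map,
    List.sum_reverse]
  congr 2
  funext d
  exact dist_comm _ _

lemma walkLength_mapLe {G G' : SimpleGraph Plane} (h : G ≤ G') {u v : Plane} (p : G.Walk u v) :
    walkLength (p.mapLe h) = walkLength p := by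
  induction p with
  | nil => rfl
  | cons hadj p ih =>
    simp only [walkLength, SimpleGraph.Walk.mapLe, SimpleGraph.Walk.map_cons,
      SimpleGraph.Walk.darts_cons, List.map_cons, List.sum_cons] at ih ⊢
    rw [ih]
    rfl

namespace HasWalk

variable {G G' : SimpleGraph Plane} {c c' : ℝ} {u v w : Plane}

lemma refl (hc : 0 ≤ c) : HasWalk G c u u := ⟨.nil, by simpa [walkLength] using hc⟩

lemma symm (h : HasWalk G c u v) : HasWalk G c v u := by
  obtain ⟨p, hp⟩ := h
  exact ⟨p.reverse, by rwa [walkLength_reverse]⟩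

lemma trans (h : HasWalk G c u v) (h' : HasWalk G c' v w) : HasWalk G (c + c') u w := by
  obtain ⟨p, hp⟩ := h
  obtain ⟨q, hq⟩ := h'
  exact ⟨p.append q, by rw [walkLength_append]; linarith⟩

lemma mono_graph (h : HasWalk G c u v) (hG : G ≤ G') : HasWalk G' c u v := by
  obtain ⟨p, hp⟩ := h
  exact ⟨p.mapLe hG, by rwa [walkLength_mapLe]⟩

lemma mono (h : HasWalk G c u v) (hc : c ≤ c') : HasWalk G c' u v := by
  obtain ⟨p, hp⟩ := h
  exact ⟨p, hp.trans hc⟩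

lemma of_adj (h : G.Adj u v) : HasWalk G (dist u v) u v :=
  ⟨h.toWalk, by simp [walkLength]⟩

end HasWalk

/-! ### Split trees and their nodes -/

lemma SplitTree.pts_nonempty (T : SplitTree) : T.pts.Nonempty := by
  induction T with
  | leaf p => exact ⟨p, Finset.mem_singleton_self p⟩
  | node l r ihl ihr => exact ihl.mono Finset.subset_union_left

lemma SplitTree.pts_left_subset (l r : SplitTree) : l.pts ⊆ (SplitTree.node l r).pts :=
  Finset.subset_union_left

lemma SplitTree.pts_right_subset (l r : SplitTree) : r.pts ⊆ (SplitTree.node l r).pts :=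
  Finset.subset_union_right

/-- The length of a longest side of the bounding box of the points below a node. -/
noncomputable def SplitTree.size (T : SplitTree) : ℝ := (bbox T.pts).maxSide

lemma SplitTree.size_nonneg (T : SplitTree) : 0 ≤ T.size := bbox_maxSide_nonneg T.pts_nonempty

lemma SplitTree.size_mono {v w : SplitTree} (h : v.pts ⊆ w.pts) : v.size ≤ w.size :=
  bbox_maxSide_mono v.pts_nonempty h

lemma SplitTree.size_node_pos {l r : SplitTree} (h : Disjoint l.pts r.pts) :
    0 < (SplitTree.node l r).size := by
  obtain ⟨p, hp⟩ := l.pts_nonempty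
  obtain ⟨q, hq⟩ := r.pts_nonempty
  refine bbox_maxSide_pos (l.pts_left_subset r hp) (l.pts_right_subset r hq) ?_
  rintro rfl
  exact Finset.disjoint_left.1 h hp hq

/-- The inner node with children `l` and `r` is halved by a line perpendicular to the direction
`i`. -/
def SplitTree.IsSplitDir (l r : SplitTree) (i : Fin 2) : Prop :=
  (∀ j, (bbox (SplitTree.node l r).pts).side j ≤ (bbox (SplitTree.node l r).pts).side i) ∧
    (∀ p ∈ l.pts, p i ≤ (bbox (SplitTree.node l r).pts).mid i) ∧
    (∀ p ∈ r.pts, (bbox (SplitTree.node l r).pts).mid i ≤ p i)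

open scoped Classical in
/-- A direction in which the node is halved. Both directions may qualify; fixing one makes the
regions of the nodes well defined. -/
noncomputable def SplitTree.splitDir (l r : SplitTree) : Fin 2 :=
  if h : ∃ i, SplitTree.IsSplitDir l r i then h.choose else 0

lemma SplitTree.Valid.isSplitDir {l r : SplitTree} (h : (SplitTree.node l r).Valid) :
    SplitTree.IsSplitDir l r (SplitTree.splitDir l r) := by
  have h' : ∃ i, SplitTree.IsSplitDir l r i := h.2.1
  rw [SplitTree.splitDir, dif_pos h']
  exact h'.choose_spec

/-- The part of the region `B` of a node that belongs to its left child. The halving line is that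
of the bounding box of the points, in general not of `B`. -/
noncomputable def SplitTree.leftRegion (l r : SplitTree) (B : Box) : Box :=
  ⟨B.lo, Function.update B.hi (splitDir l r)
    ((bbox (SplitTree.node l r).pts).mid (splitDir l r))⟩

/-- The part of the region `B` of a node that belongs to its right child. -/
noncomputable def SplitTree.rightRegion (l r : SplitTree) (B : Box) : Box :=
  ⟨Function.update B.lo (splitDir l r) ((bbox (SplitTree.node l r).pts).mid (splitDir l r)), B.hi⟩

/-- A node of a split tree together with its parent (the root is its own parent) and with the
region of the plane assigned to it. -/
structure SplitNode where
  parent : SplitTree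
  tree : SplitTree
  region : Box

/-- The nodes of the split tree `T`, whose root has the parent `q` and the region `B`. -/
def SplitTree.nodes : SplitTree → SplitTree → Box → Set SplitNode
  | .leaf p, q, B => {⟨q, .leaf p, B⟩}
  | .node l r, q, B => insert ⟨q, .node l r, B⟩
      (l.nodes (.node l r) (leftRegion l r B) ∪ r.nodes (.node l r) (rightRegion l r B))

lemma SplitTree.root_mem_nodes (T q : SplitTree) (B : Box) : ⟨q, T, B⟩ ∈ T.nodes q B := by
  cases T with
  | leaf p => rfl
  | node l r => exact Set.mem_insert _ _

lemma SplitTree.parent_pts_subset_of_mem_nodes {T q : SplitTree} {B : Box} {x : SplitNode}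
    (hx : x ∈ T.nodes q B) : x = ⟨q, T, B⟩ ∨ x.parent.pts ⊆ T.pts := by
  induction T generalizing q B with
  | leaf p => exact Or.inl hx
  | node l r ihl ihr =>
    rcases hx with hx | hx | hx
    · exact Or.inl hx
    · right
      rcases ihl hx with rfl | h
      · exact subset_rfl
      · exact h.trans (l.pts_left_subset r)
    · right
      rcases ihr hx with rfl | h
      · exact subset_rfl
      · exact h.trans (l.pts_right_subset r)

lemma SplitTree.children_mem_nodes {T q q' l r : SplitTree} {B B' : Box}
    (h : ⟨q', .node l r, B'⟩ ∈ T.nodes q B) :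
    ⟨.node l r, l, leftRegion l r B'⟩ ∈ T.nodes q B ∧
      ⟨.node l r, r, rightRegion l r B'⟩ ∈ T.nodes q B := by
  induction T generalizing q B with
  | leaf p => cases h
  | node l₀ r₀ ihl ihr =>
    rcases h with h | h | h
    · cases h
      exact ⟨Or.inr (Or.inl (root_mem_nodes _ _ _)), Or.inr (Or.inr (root_mem_nodes _ _ _))⟩
    · exact ⟨Or.inr (Or.inl (ihl h).1), Or.inr (Or.inl (ihl h).2)⟩
    · exact ⟨Or.inr (Or.inr (ihr h).1), Or.inr (Or.inr (ihr h).2)⟩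

open scoped Classical in
/-- The inner nodes of a split tree. -/
noncomputable def SplitTree.inner : SplitTree → Finset SplitTree
  | .leaf _ => ∅
  | .node l r => insert (.node l r) (l.inner ∪ r.inner)

lemma SplitTree.mem_inner_of_mem_nodes {T q q' l r : SplitTree} {B B' : Box}
    (h : ⟨q', .node l r, B'⟩ ∈ T.nodes q B) : .node l r ∈ T.inner := by
  classical
  induction T generalizing q B with
  | leaf p => cases h
  | node l₀ r₀ ihl ihr =>
    rw [inner, Finset.mem_insert, Finset.mem_union]
    rcases h with h | h | h
    · cases h
      exact Or.inl rfl
    · exact Or.inr (Or.inl (ihl h))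
    · exact Or.inr (Or.inr (ihr h))

lemma SplitTree.size_pos_of_mem_inner {T p : SplitTree} (hT : T.Valid) (hp : p ∈ T.inner) :
    0 < p.size := by
  classical
  induction T with
  | leaf _ => simp [inner] at hp
  | node l r ihl ihr =>
    rw [inner, Finset.mem_insert, Finset.mem_union] at hp
    rcases hp with rfl | h | h
    · exact size_node_pos hT.1
    · exact ihl hT.2.2.1 h
    · exact ihr hT.2.2.2 h

lemma SplitTree.card_inner_lt {T : SplitTree} (hT : T.Valid) : T.inner.card < T.pts.card := by
  classical
  induction T with
  | leaf p => simp [inner, pts]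
  | node l r ihl ihr =>
    have h1 := ihl hT.2.2.1
    have h2 := ihr hT.2.2.2
    have h3 : (SplitTree.node l r).pts.card = l.pts.card + r.pts.card :=
      Finset.card_union_of_disjoint hT.1
    have h4 : (SplitTree.node l r).inner.card ≤ (l.inner ∪ r.inner).card + 1 :=
      Finset.card_insert_le _ _
    have h5 := Finset.card_union_le l.inner r.inner
    omega

/-- The region of a node is large enough: it contains the points below the node, and its sides are
at least half as long as the bounding box of the points below the parent, even if the bounding box
of the node itself is tiny. -/
def SplitNode.IsFat (x : SplitNode) : Prop :=
  (x.tree.pts : Set Plane) ⊆ x.region.toSet ∧ ∀ i, x.parent.size / 2 ≤ x.region.side i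

/-- The half of the region that belongs to a child is large enough: in the split direction it
contains half of the bounding box of the node, in the other direction it is not cut. -/
lemma SplitTree.isFat_left {q l r : SplitTree} {B : Box} (hT : (SplitTree.node l r).Valid)
    (hq : (SplitTree.node l r).pts ⊆ q.pts) (h : SplitNode.IsFat ⟨q, .node l r, B⟩) :
    SplitNode.IsFat ⟨.node l r, l, leftRegion l r B⟩ ∧
      (leftRegion l r B).halfOpen ⊆ B.halfOpen := by
  obtain ⟨hdir, hl, -⟩ := hT.isSplitDir
  set i := splitDir l r with hi
  have hmax := Box.maxSide_eq_of_forall_le hdir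
  obtain ⟨h1, h2⟩ := h
  have hsize := size_mono hq
  obtain ⟨p, hp, hpe⟩ := exists_eq_bbox_lo (SplitTree.node l r).pts_nonempty i
  obtain ⟨p', hp', hpe'⟩ := exists_eq_bbox_hi (SplitTree.node l r).pts_nonempty i
  have hplo := (h1 hp i).1
  have hphi := (h1 hp' i).2
  have hpos := (SplitTree.node l r).size_nonneg
  simp only at h2
  change _ = (SplitTree.node l r).size at hmax
  refine ⟨⟨fun y hy j => ?_, fun j => ?_⟩, fun c hc j => ?_⟩
  · have hyB := h1 (l.pts_left_subset r hy) j
    rcases eq_or_ne j i with rfl | hj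
    · simpa [leftRegion, ← hi] using ⟨hyB.1, hl y hy⟩
    · simpa [leftRegion, ← hi, hj] using hyB
  · rcases eq_or_ne j i with rfl | hj
    · simp only [leftRegion, ← hi, Box.side, Function.update_self, Box.mid] at hmax ⊢
      linarith
    · have := h2 j
      simp only [leftRegion, ← hi, Box.side, Function.update_of_ne hj] at this ⊢
      linarith
  · have hcj := hc j
    rcases eq_or_ne j i with rfl | hj
    · simp only [leftRegion, ← hi, Box.side, Function.update_self, Box.mid] at hmax hcj ⊢
      exact ⟨hcj.1, by linarith⟩
    · simpa only [leftRegion, ← hi, Function.update_of_ne hj] using hcj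

lemma SplitTree.isFat_right {q l r : SplitTree} {B : Box} (hT : (SplitTree.node l r).Valid)
    (hq : (SplitTree.node l r).pts ⊆ q.pts) (h : SplitNode.IsFat ⟨q, .node l r, B⟩) :
    SplitNode.IsFat ⟨.node l r, r, rightRegion l r B⟩ ∧
      (rightRegion l r B).halfOpen ⊆ B.halfOpen := by
  obtain ⟨hdir, -, hr⟩ := hT.isSplitDir
  set i := splitDir l r with hi
  have hmax := Box.maxSide_eq_of_forall_le hdir
  obtain ⟨h1, h2⟩ := h
  have hsize := size_mono hq
  obtain ⟨p, hp, hpe⟩ := exists_eq_bbox_lo (SplitTree.node l r).pts_nonempty i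
  obtain ⟨p', hp', hpe'⟩ := exists_eq_bbox_hi (SplitTree.node l r).pts_nonempty i
  have hplo := (h1 hp i).1
  have hphi := (h1 hp' i).2
  have hpos := (SplitTree.node l r).size_nonneg
  simp only at h2
  change _ = (SplitTree.node l r).size at hmax
  refine ⟨⟨fun y hy j => ?_, fun j => ?_⟩, fun c hc j => ?_⟩
  · have hyB := h1 (l.pts_right_subset r hy) j
    rcases eq_or_ne j i with rfl | hj
    · simpa [rightRegion, ← hi] using ⟨hr y hy, hyB.2⟩
    · simpa [rightRegion, ← hi, hj] using hyB
  · rcases eq_or_ne j i with rfl | hj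
    · simp only [rightRegion, ← hi, Box.side, Function.update_self, Box.mid] at hmax ⊢
      linarith
    · have := h2 j
      simp only [rightRegion, ← hi, Box.side, Function.update_of_ne hj] at this ⊢
      linarith
  · have hcj := hc j
    rcases eq_or_ne j i with rfl | hj
    · simp only [rightRegion, ← hi, Box.side, Function.update_self, Box.mid] at hmax hcj ⊢
      exact ⟨by linarith, hcj.2⟩
    · simpa only [rightRegion, ← hi, Function.update_of_ne hj] using hcj

lemma SplitTree.isFat_of_mem_nodes {T q : SplitTree} {B : Box} (hT : T.Valid)
    (hq : T.pts ⊆ q.pts) (h : SplitNode.IsFat ⟨q, T, B⟩) {x : SplitNode}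
    (hx : x ∈ T.nodes q B) : x.IsFat ∧ x.region.halfOpen ⊆ B.halfOpen := by
  induction T generalizing q B with
  | leaf p => cases hx; exact ⟨h, subset_rfl⟩
  | node l r ihl ihr =>
    rcases hx with rfl | hx | hx
    · exact ⟨h, subset_rfl⟩
    · have h' := isFat_left hT hq h
      have := ihl hT.2.2.1 (l.pts_left_subset r) h'.1 hx
      exact ⟨this.1, this.2.trans h'.2⟩
    · have h' := isFat_right hT hq h
      have := ihr hT.2.2.2 (l.pts_right_subset r) h'.1 hx
      exact ⟨this.1, this.2.trans h'.2⟩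

/-- Nodes whose half-open regions intersect are comparable: they are equal, or the parent of one of
them lies below the other. -/
lemma SplitTree.nested_of_mem_halfOpen {T q : SplitTree} {B : Box} (hT : T.Valid)
    (hq : T.pts ⊆ q.pts) (h : SplitNode.IsFat ⟨q, T, B⟩) {x y : SplitNode}
    (hx : x ∈ T.nodes q B) (hy : y ∈ T.nodes q B) {c : Fin 2 → ℝ} (hcx : c ∈ x.region.halfOpen)
    (hcy : c ∈ y.region.halfOpen) :
    x = y ∨ y.parent.pts ⊆ x.tree.pts ∨ x.parent.pts ⊆ y.tree.pts := by
  induction T generalizing q B with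
  | leaf p => cases hx; cases hy; exact Or.inl rfl
  | node l r ihl ihr =>
    by_cases hx0 : x = ⟨q, .node l r, B⟩
    · rcases parent_pts_subset_of_mem_nodes hy with hy0 | hy0
      · exact Or.inl (hx0.trans hy0.symm)
      · exact Or.inr (Or.inl (by rwa [hx0]))
    by_cases hy0 : y = ⟨q, .node l r, B⟩
    · rcases parent_pts_subset_of_mem_nodes hx with hx1 | hx1
      · exact absurd hx1 hx0
      · exact Or.inr (Or.inr (by rwa [hy0]))
    have hfl := isFat_left hT hq h
    have hfr := isFat_right hT hq h
    have hsep : ∀ {c}, c ∈ (leftRegion l r B).halfOpen → c ∈ (rightRegion l r B).halfOpen →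
        False := by
      intro c h1 h2
      have h1 := (h1 (splitDir l r)).2
      have h2 := (h2 (splitDir l r)).1
      simp only [leftRegion, rightRegion, Function.update_self] at h1 h2
      linarith
    rcases hx.resolve_left hx0 with hx | hx <;> rcases hy.resolve_left hy0 with hy | hy
    · exact ihl hT.2.2.1 (l.pts_left_subset r) hfl.1 hx hy
    · exact (hsep ((isFat_of_mem_nodes hT.2.2.1 (l.pts_left_subset r) hfl.1 hx).2 hcx)
        ((isFat_of_mem_nodes hT.2.2.2 (l.pts_right_subset r) hfr.1 hy).2 hcy)).elim
    · exact (hsep ((isFat_of_mem_nodes hT.2.2.1 (l.pts_left_subset r) hfl.1 hy).2 hcy)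
        ((isFat_of_mem_nodes hT.2.2.2 (l.pts_right_subset r) hfr.1 hx).2 hcx)).elim
    · exact ihr hT.2.2.2 (l.pts_right_subset r) hfr.1 hx hy

/-! ### The size of the well-separated pair decomposition -/

lemma WellSeparated.symm {s : ℝ} {A B : Finset Plane} (h : WellSeparated s A B) :
    WellSeparated s B A := by
  obtain ⟨a, b, r, h0, h1, h2, h3, h4⟩ := h
  exact ⟨b, a, r, h0, h2, h1, by rwa [dist_comm], by rwa [dist_comm]⟩

lemma abs_sub_center_le {B : Box} {y : Plane} (hy : y ∈ B.toSet) (i : Fin 2) :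
    |y i - B.center i| ≤ B.maxSide / 2 := by
  have h1 := hy i
  have h2 := B.side_le_maxSide i
  have h3 : B.center i = (B.lo i + B.hi i) / 2 := rfl
  unfold Box.side at h2
  rw [h3, abs_le]
  constructor <;> linarith

lemma dist_center_le_of_not_wellSeparated {s ℓ : ℝ} (hs : 0 ≤ s) (hℓ : 0 ≤ ℓ) {A B : Finset Plane}
    (hA : (bbox A).maxSide ≤ ℓ) (hB : (bbox B).maxSide ≤ ℓ) (h : ¬ WellSeparated s A B) :
    dist (bbox A).center (bbox B).center ≤ (s + 2) * ℓ := by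
  by_contra! hd
  refine h ⟨(bbox A).center, (bbox B).center, ℓ, hℓ, fun y hy => ?_, fun y hy => ?_, ?_, ?_⟩
  · refine (dist_le_of_coord fun i => abs_sub_center_le hy i).trans ?_
    linarith
  · refine (dist_le_of_coord fun i => abs_sub_center_le hy i).trans ?_
    linarith
  · nlinarith
  · nlinarith

/-- The half-open region of a node `x` contains a lattice point from a block of bounded size
around the inner node `p`, if `x` is no larger than `p`, its parent is no smaller than `p`, and the
two nodes are not well separated. -/
lemma exists_latticePoint_of_not_wellSeparated {s : ℝ} (hs : 0 ≤ s) {p : SplitTree}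
    (hp : 0 < p.size) {x : SplitNode} (hx : x.IsFat) (h1 : x.tree.size ≤ p.size)
    (h2 : p.size ≤ x.parent.size) (h : ¬ WellSeparated s p.pts x.tree.pts) :
    ∃ j ∈ latticeBlock ⌈4 * s + 13⌉,
      latticePoint (bbox p.pts).center (p.size / 4) j ∈ x.region.halfOpen := by
  obtain ⟨y, hy⟩ := x.tree.pts_nonempty
  have hd := dist_center_le_of_not_wellSeparated hs hp.le le_rfl h1 h
  refine exists_latticePoint_mem_halfOpen (y := y) (ρ := (s + 3) * p.size) (by linarith)
    (fun i => by linarith [hx.2 i]) (hx.1 hy) ?_ fun i => ?_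
  · have := Int.le_ceil (4 * s + 13)
    nlinarith
  · have h3 := abs_sub_center_le (mem_bbox hy) i
    have h4 := abs_sub_le_dist (bbox p.pts).center (bbox x.tree.pts).center i
    have h5 := abs_sub_le (y i) ((bbox x.tree.pts).center i) ((bbox p.pts).center i)
    rw [abs_sub_comm ((bbox x.tree.pts).center i)] at h5
    change (bbox x.tree.pts).maxSide ≤ p.size at h1
    linarith

/-- The relation between a node `x` and a node `p` that is split in a call of `FindPairs` with the
nodes `x` and `p`, in this order. -/
def IsLeftPartner (p : SplitTree) (x : SplitNode) : Prop :=
  x.tree.size ≤ p.size ∧ (p.size < x.parent.size ∨ p.pts ⊆ x.parent.pts) ∧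
    Disjoint x.tree.pts p.pts

/-- The relation between a node `x` and a node `p` that is split in a call of `FindPairs` with the
nodes `p` and `x`, in this order. -/
def IsRightPartner (p : SplitTree) (x : SplitNode) : Prop :=
  x.tree.size < p.size ∧ p.size ≤ x.parent.size

/-- The pair `X` is charged to the inner node with children `l` and `r`, a child of which (chosen
by `b`) is paired with the node `x`. -/
def IsCharged (s : ℝ) (l r : SplitTree) (b : Bool) (x : SplitNode)
    (X : Finset Plane × Finset Plane) : Prop :=
  ¬ WellSeparated s (SplitTree.node l r).pts x.tree.pts ∧
    (IsLeftPartner (.node l r) x ∧ X = (x.tree.pts, (bif b then l else r).pts) ∨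
      IsRightPartner (.node l r) x ∧ X = ((bif b then l else r).pts, x.tree.pts))

/-- A reported pair is the pair of nodes the search was started with, or it arose by splitting an
inner node, to which it is charged. -/
lemma FindPairs.exists_isCharged {s : ℝ} {T q : SplitTree} {B : Box} {v w : SplitTree}
    {L : List (Finset Plane × Finset Plane)} (hL : FindPairs s v w L) {qv qw : SplitTree}
    {Bv Bw : Box} (hv : ⟨qv, v, Bv⟩ ∈ T.nodes q B) (hw : ⟨qw, w, Bw⟩ ∈ T.nodes q B)
    (hvw : Disjoint v.pts w.pts) (h1 : w.size < qv.size ∨ w.pts ⊆ qv.pts)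
    (h2 : v.size ≤ qw.size) {X : Finset Plane × Finset Plane} (hX : X ∈ L) :
    X = (v.pts, w.pts) ∨
      ∃ l r b x, .node l r ∈ T.inner ∧ x ∈ T.nodes q B ∧ IsCharged s l r b x X := by
  -- `h1` and `h2` say that the parent of either node is no smaller than the other node; they
  -- are kept because a call always splits the larger node.
  induction hL generalizing qv qw Bv Bw with
  | separated h => exact Or.inl (List.mem_singleton.1 hX)
  | @splitRight v l r L₁ L₂ hns hle _ _ ih1 ih2 =>
    have hc := SplitTree.children_mem_nodes hw
    have hI := SplitTree.mem_inner_of_mem_nodes hw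
    have hpart : IsLeftPartner (.node l r) ⟨qv, v, Bv⟩ := ⟨hle, h1, hvw⟩
    have hns' := fun h => hns (WellSeparated.symm h)
    rcases List.mem_append.1 hX with hX | hX
    · rcases ih1 hv hc.1 (hvw.mono_right (l.pts_left_subset r))
        (h1.imp (SplitTree.size_mono (l.pts_left_subset r)).trans_lt
          (l.pts_left_subset r).trans) hle hX with rfl | h
      · exact Or.inr ⟨l, r, true, _, hI, hv, hns', Or.inl ⟨hpart, rfl⟩⟩
      · exact Or.inr h
    · rcases ih2 hv hc.2 (hvw.mono_right (l.pts_right_subset r))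
        (h1.imp (SplitTree.size_mono (l.pts_right_subset r)).trans_lt
          (l.pts_right_subset r).trans) hle hX with rfl | h
      · exact Or.inr ⟨l, r, false, _, hI, hv, hns', Or.inl ⟨hpart, rfl⟩⟩
      · exact Or.inr h
  | @splitLeft l r w L₁ L₂ hns hlt _ _ ih1 ih2 =>
    have hc := SplitTree.children_mem_nodes hv
    have hI := SplitTree.mem_inner_of_mem_nodes hv
    have hpart : IsRightPartner (.node l r) ⟨qw, w, Bw⟩ := ⟨hlt, h2⟩
    rcases List.mem_append.1 hX with hX | hX
    · rcases ih1 hc.1 hw (hvw.mono_left (l.pts_left_subset r)) (Or.inl hlt)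
        ((SplitTree.size_mono (l.pts_left_subset r)).trans h2) hX with rfl | h
      · exact Or.inr ⟨l, r, true, _, hI, hw, hns, Or.inr ⟨hpart, rfl⟩⟩
      · exact Or.inr h
    · rcases ih2 hc.2 hw (hvw.mono_left (l.pts_right_subset r)) (Or.inl hlt)
        ((SplitTree.size_mono (l.pts_right_subset r)).trans h2) hX with rfl | h
      · exact Or.inr ⟨l, r, false, _, hI, hw, hns, Or.inr ⟨hpart, rfl⟩⟩
      · exact Or.inr h

lemma ComputeWSPD.exists_isCharged {s : ℝ} {T q T' : SplitTree} {B : Box}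
    {L : List (Finset Plane × Finset Plane)} (hL : ComputeWSPD s T' L) (hT' : T'.Valid)
    {q' : SplitTree} {B' : Box} (hmem : ⟨q', T', B'⟩ ∈ T.nodes q B)
    {X : Finset Plane × Finset Plane} (hX : X ∈ L) :
    (∃ l r, .node l r ∈ T.inner ∧ X = (l.pts, r.pts)) ∨
      ∃ l r b x, .node l r ∈ T.inner ∧ x ∈ T.nodes q B ∧ IsCharged s l r b x X := by
  induction hL generalizing q' B' with
  | leaf p => cases hX
  | @node l r L₀ L₁ L₂ hF _ _ ih1 ih2 =>
    have hc := SplitTree.children_mem_nodes hmem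
    rw [List.mem_append, List.mem_append] at hX
    rcases hX with (hX | hX) | hX
    · refine (hF.exists_isCharged hc.1 hc.2 hT'.1 (Or.inr (l.pts_right_subset r))
        (SplitTree.size_mono (l.pts_left_subset r)) hX).imp_left fun h => ?_
      exact ⟨l, r, SplitTree.mem_inner_of_mem_nodes hmem, h⟩
    · exact ih1 hT'.2.2.1 hc.1 hX
    · exact ih2 hT'.2.2.2 hc.2 hX

lemma IsLeftPartner.size_le {p : SplitTree} {x : SplitNode} (h : IsLeftPartner p x) :
    x.tree.size ≤ p.size ∧ p.size ≤ x.parent.size :=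
  ⟨h.1, h.2.1.elim le_of_lt SplitTree.size_mono⟩

/-- Two left partners of the same node are not nested. -/
lemma IsLeftPartner.not_parent_subset {p : SplitTree} {x y : SplitNode} (hx : IsLeftPartner p x)
    (hy : IsLeftPartner p y) : ¬ y.parent.pts ⊆ x.tree.pts := by
  intro h
  rcases hy.2.1 with hy | hy
  · linarith [SplitTree.size_mono h, hx.1]
  · obtain ⟨c, hc⟩ := p.pts_nonempty
    exact Finset.disjoint_left.1 hx.2.2 (h (hy hc)) hc

/-- Two right partners of the same node are not nested. -/
lemma IsRightPartner.not_parent_subset {p : SplitTree} {x y : SplitNode} (hx : IsRightPartner p x)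
    (hy : IsRightPartner p y) : ¬ y.parent.pts ⊆ x.tree.pts := by
  intro h
  linarith [SplitTree.size_mono h, hx.1, hy.2]

/-- The region of the root: the square with the lower left corner and a longest side of the
bounding box. -/
noncomputable def SplitTree.rootRegion (T : SplitTree) : Box :=
  ⟨(bbox T.pts).lo, fun i => (bbox T.pts).lo i + T.size⟩

lemma SplitTree.isFat_root (T : SplitTree) : SplitNode.IsFat ⟨T, T, T.rootRegion⟩ := by
  refine ⟨fun y hy i => ⟨bbox_lo_le hy i, ?_⟩, fun i => ?_⟩
  · have h1 := le_bbox_hi hy i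
    have h2 := (bbox T.pts).side_le_maxSide i
    change y i ≤ (bbox T.pts).lo i + (bbox T.pts).maxSide
    unfold Box.side at h2
    linarith
  · have := T.size_nonneg
    change T.size / 2 ≤ (bbox T.pts).lo i + T.size - (bbox T.pts).lo i
    linarith

/-- The constant in the linear bound on the size of a well-separated pair decomposition with
separation ratio `s`. -/
noncomputable def wspdConst (s : ℝ) : ℕ := 1 + 4 * (latticeBlock ⌈4 * s + 13⌉).card

open scoped Classical in
/-- The well-separated pair decomposition has linear size: a reported pair that is not the pair of
children of a node is charged to the node split last, to the child that belongs to the pair, and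
to a lattice point in the region of the other node of the pair. -/
theorem ComputeWSPD.card_le {s : ℝ} (hs : 0 ≤ s) {T : SplitTree} (hT : T.Valid)
    {L : List (Finset Plane × Finset Plane)} (hL : ComputeWSPD s T L) :
    L.toFinset.card ≤ wspdConst s * T.pts.card := by
  set J := latticeBlock ⌈4 * s + 13⌉ with hJ
  let N := T.nodes T T.rootRegion
  -- A label consists of an inner node, and of `none` for the pair of its children, or else of the
  -- side on which the node was split, the child, and a lattice point.
  let Λ : Finset (SplitTree × Option (Bool × Bool × (Fin 2 → ℤ))) :=
    T.inner ×ˢ Finset.insertNone (Finset.univ ×ˢ Finset.univ ×ˢ J)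
  let pt (p : SplitTree) (j : Fin 2 → ℤ) := latticePoint (bbox p.pts).center (p.size / 4) j
  let R : Finset Plane × Finset Plane → SplitTree × Option (Bool × Bool × (Fin 2 → ℤ)) → Prop :=
    fun X lab => ∃ l r, lab.1 = .node l r ∧
      (lab.2 = none ∧ X = (l.pts, r.pts) ∨
      ∃ x ∈ N, ∃ b j, pt (.node l r) j ∈ x.region.halfOpen ∧
        (lab.2 = some (true, b, j) ∧ IsLeftPartner (.node l r) x ∧
          X = (x.tree.pts, (bif b then l else r).pts) ∨
        lab.2 = some (false, b, j) ∧ IsRightPartner (.node l r) x ∧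
          X = ((bif b then l else r).pts, x.tree.pts)))
  have hcard : L.toFinset.card ≤ Λ.card := by
    refine card_le_card_of_labels R (fun X hX => ?_) ?_
    · rw [List.mem_toFinset] at hX
      rcases hL.exists_isCharged hT (T.root_mem_nodes T T.rootRegion) hX with
        ⟨l, r, hI, hX⟩ | ⟨l, r, b, x, hI, hx, hns, h⟩
      · exact ⟨(.node l r, none), by simp [Λ, hI], l, r, rfl, Or.inl ⟨rfl, hX⟩⟩
      · have hfat := (T.isFat_of_mem_nodes hT subset_rfl T.isFat_root hx).1
        have hsize : x.tree.size ≤ (SplitTree.node l r).size ∧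
            (SplitTree.node l r).size ≤ x.parent.size :=
          h.elim (fun h => h.1.size_le) fun h => ⟨h.1.1.le, h.1.2⟩
        obtain ⟨j, hj, hj'⟩ := exists_latticePoint_of_not_wellSeparated hs
          (SplitTree.size_pos_of_mem_inner hT hI) hfat hsize.1 hsize.2 hns
        rw [← hJ] at hj
        rcases h with h | h
        · exact ⟨(.node l r, some (true, b, j)), by simp [Λ, hI, hj], l, r, rfl,
            Or.inr ⟨x, hx, b, j, hj', Or.inl ⟨rfl, h⟩⟩⟩
        · exact ⟨(.node l r, some (false, b, j)), by simp [Λ, hI, hj], l, r, rfl,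
            Or.inr ⟨x, hx, b, j, hj', Or.inr ⟨rfl, h⟩⟩⟩
    · rintro X - Y - ⟨p, o⟩ - ⟨l, r, hp, hX⟩ ⟨l', r', hp', hY⟩
      simp only at hp hp' hX hY
      subst hp
      cases hp'
      rcases hX with ⟨ho, hX⟩ | ⟨x, hx, b, j, hj, ⟨ho, hp, hX⟩ | ⟨ho, hp, hX⟩⟩ <;>
      rcases hY with ⟨ho', hY⟩ | ⟨y, hy, b', j', hj', ⟨ho', hp', hY⟩ | ⟨ho', hp', hY⟩⟩ <;>
      subst ho <;> cases ho'
      · rw [hX, hY]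
      · rcases SplitTree.nested_of_mem_halfOpen hT subset_rfl T.isFat_root hx hy hj hj' with
          rfl | h | h
        · rw [hX, hY]
        · exact absurd h (hp.not_parent_subset hp')
        · exact absurd h (hp'.not_parent_subset hp)
      · rcases SplitTree.nested_of_mem_halfOpen hT subset_rfl T.isFat_root hx hy hj hj' with
          rfl | h | h
        · rw [hX, hY]
        · exact absurd h (hp.not_parent_subset hp')
        · exact absurd h (hp'.not_parent_subset hp)
  have hΛ : Λ.card = T.inner.card * wspdConst s := by
    simp only [Λ, Finset.card_product, Finset.card_insertNone, Finset.card_univ,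
      Fintype.card_bool, wspdConst, ← hJ]
    ring
  calc L.toFinset.card ≤ T.inner.card * wspdConst s := hcard.trans hΛ.le
    _ ≤ T.pts.card * wspdConst s := Nat.mul_le_mul_right _ (SplitTree.card_inner_lt hT).le
    _ = _ := mul_comm _ _

/-! ### Existence and coverage of the well-separated pair decomposition -/

/-- Every nonempty finite point set has a split tree. -/
theorem exists_splitTree {Q : Finset Plane} (hQ : Q.Nonempty) :
    ∃ T : SplitTree, T.Valid ∧ T.pts = Q := by
  classical
  induction Q using Finset.strongInduction with
  | H Q ih =>
  by_cases hone : ∃ p, Q = {p}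
  · obtain ⟨p, rfl⟩ := hone
    exact ⟨.leaf p, trivial, rfl⟩
  obtain ⟨p, hp, q, hq, hpq⟩ : Q.Nontrivial := by
    rcases Finset.Nonempty.exists_eq_singleton_or_nontrivial hQ with h | h
    · exact absurd h hone
    · exact h
  have hpos := bbox_maxSide_pos hp hq hpq
  obtain ⟨i, hi⟩ : ∃ i : Fin 2, ∀ j, (bbox Q).side j ≤ (bbox Q).side i := by
    rcases le_total ((bbox Q).side 0) ((bbox Q).side 1) with h | h
    · exact ⟨1, fun j => by fin_cases j <;> simp [h]⟩
    · exact ⟨0, fun j => by fin_cases j <;> simp [h]⟩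
  have hside : 0 < (bbox Q).hi i - (bbox Q).lo i := by
    rw [← Box.maxSide_eq_of_forall_le hi] at hpos
    exact hpos
  have hmid : (bbox Q).mid i = ((bbox Q).lo i + (bbox Q).hi i) / 2 := rfl
  obtain ⟨x, hx, hx'⟩ := exists_eq_bbox_lo hQ i
  obtain ⟨y, hy, hy'⟩ := exists_eq_bbox_hi hQ i
  set A := Q.filter fun z => z i ≤ (bbox Q).mid i with hA
  set B := Q.filter fun z => ¬ z i ≤ (bbox Q).mid i with hB
  have hxA : x ∈ A := Finset.mem_filter.2 ⟨hx, by linarith⟩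
  have hyB : y ∈ B := Finset.mem_filter.2 ⟨hy, by linarith⟩
  have hAQ : A ⊂ Q := Finset.filter_ssubset.2 ⟨y, hy, by linarith⟩
  have hBQ : B ⊂ Q := Finset.filter_ssubset.2 ⟨x, hx, by simp only [not_not]; linarith⟩
  obtain ⟨l, hl, hlA⟩ := ih A hAQ ⟨x, hxA⟩
  obtain ⟨r, hr, hrB⟩ := ih B hBQ ⟨y, hyB⟩
  have hpts : (SplitTree.node l r).pts = Q := by
    rw [SplitTree.pts, hlA, hrB]
    exact Finset.filter_union_filter_not_eq _ _
  refine ⟨.node l r, ⟨?_, ⟨i, ?_⟩, hl, hr⟩, hpts⟩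
  · rw [hlA, hrB]
    exact Finset.disjoint_filter_filter_not _ _ _
  · rw [hpts, hlA, hrB]
    exact ⟨hi, fun z hz => (Finset.mem_filter.1 hz).2,
      fun z hz => (not_le.1 (Finset.mem_filter.1 hz).2).le⟩

lemma bbox_singleton_eq {p y : Plane} (hy : y ∈ (bbox {p}).toSet) : y = p := by
  refine PiLp.ext fun i => ?_
  have := hy i
  simp only [bbox, Finset.coe_singleton, Set.image_singleton, csInf_singleton,
    csSup_singleton] at this
  linarith

lemma wellSeparated_singleton (s : ℝ) {p q : Plane} (h : p ≠ q) : WellSeparated s {p} {q} := by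
  have := dist_pos.2 h
  refine ⟨p, q, 0, le_rfl, fun y hy => ?_, fun y hy => ?_, by linarith, by linarith⟩
  · simp [bbox_singleton_eq hy]
  · simp [bbox_singleton_eq hy]

lemma SplitTree.size_leaf (p : Plane) : (SplitTree.leaf p).size = 0 := by
  simp [SplitTree.size, SplitTree.pts, bbox, Box.maxSide, Box.side]

/-- The search for well-separated pairs terminates. -/
lemma exists_findPairs (s : ℝ) {v w : SplitTree} (hv : v.Valid) (hw : w.Valid)
    (h : Disjoint v.pts w.pts) : ∃ L, FindPairs s v w L := by
  induction v generalizing w with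
  | leaf p =>
    induction w with
    | leaf q =>
      refine ⟨_, .separated (wellSeparated_singleton s ?_)⟩
      rintro rfl
      simp [SplitTree.pts] at h
    | node l r ihl ihr =>
      by_cases hs : WellSeparated s (SplitTree.leaf p).pts (SplitTree.node l r).pts
      · exact ⟨_, .separated hs⟩
      obtain ⟨L₁, h₁⟩ := ihl hw.2.2.1 (h.mono_right (l.pts_left_subset r))
      obtain ⟨L₂, h₂⟩ := ihr hw.2.2.2 (h.mono_right (l.pts_right_subset r))
      refine ⟨_, .splitRight hs ?_ h₁ h₂⟩
      exact (SplitTree.size_leaf p).le.trans (SplitTree.size_nonneg _)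
  | node l r ihl ihr =>
    have hsplit : ∀ {w : SplitTree}, w.Valid → Disjoint (SplitTree.node l r).pts w.pts →
        ¬ WellSeparated s (SplitTree.node l r).pts w.pts → w.size < (SplitTree.node l r).size →
        ∃ L, FindPairs s (.node l r) w L := by
      intro w hw h hs hlt
      obtain ⟨L₁, h₁⟩ := ihl hv.2.2.1 hw (h.mono_left (l.pts_left_subset r))
      obtain ⟨L₂, h₂⟩ := ihr hv.2.2.2 hw (h.mono_left (l.pts_right_subset r))
      exact ⟨_, .splitLeft hs hlt h₁ h₂⟩
    induction w with
    | leaf q =>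
      by_cases hs : WellSeparated s (SplitTree.node l r).pts (SplitTree.leaf q).pts
      · exact ⟨_, .separated hs⟩
      refine hsplit hw h hs ?_
      rw [SplitTree.size_leaf]
      exact SplitTree.size_node_pos hv.1
    | node l' r' ihl' ihr' =>
      by_cases hs : WellSeparated s (SplitTree.node l r).pts (SplitTree.node l' r').pts
      · exact ⟨_, .separated hs⟩
      rcases lt_or_ge (SplitTree.node l' r').size (SplitTree.node l r).size with hlt | hle
      · exact hsplit hw h hs hlt
      obtain ⟨L₁, h₁⟩ := ihl' hw.2.2.1 (h.mono_right (l'.pts_left_subset r'))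
      obtain ⟨L₂, h₂⟩ := ihr' hw.2.2.2 (h.mono_right (l'.pts_right_subset r'))
      exact ⟨_, .splitRight hs hle h₁ h₂⟩

lemma exists_computeWSPD (s : ℝ) {T : SplitTree} (hT : T.Valid) : ∃ L, ComputeWSPD s T L := by
  induction T with
  | leaf p => exact ⟨_, .leaf p⟩
  | node l r ihl ihr =>
    obtain ⟨L₀, h₀⟩ := exists_findPairs s hT.2.2.1 hT.2.2.2 hT.1
    obtain ⟨L₁, h₁⟩ := ihl hT.2.2.1
    obtain ⟨L₂, h₂⟩ := ihr hT.2.2.2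
    exact ⟨_, .node h₀ h₁ h₂⟩

lemma FindPairs.exists_mem {s : ℝ} {v w : SplitTree} {L : List (Finset Plane × Finset Plane)}
    (hL : FindPairs s v w L) {p q : Plane} (hp : p ∈ v.pts) (hq : q ∈ w.pts) :
    ∃ X ∈ L, p ∈ X.1 ∧ q ∈ X.2 := by
  induction hL with
  | separated _ => exact ⟨_, List.mem_singleton_self _, hp, hq⟩
  | splitRight _ _ _ _ ih1 ih2 =>
    rcases Finset.mem_union.1 hq with hq | hq
    · obtain ⟨X, hX, h⟩ := ih1 hp hq
      exact ⟨X, List.mem_append_left _ hX, h⟩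
    · obtain ⟨X, hX, h⟩ := ih2 hp hq
      exact ⟨X, List.mem_append_right _ hX, h⟩
  | splitLeft _ _ _ _ ih1 ih2 =>
    rcases Finset.mem_union.1 hp with hp | hp
    · obtain ⟨X, hX, h⟩ := ih1 hp hq
      exact ⟨X, List.mem_append_left _ hX, h⟩
    · obtain ⟨X, hX, h⟩ := ih2 hp hq
      exact ⟨X, List.mem_append_right _ hX, h⟩

lemma FindPairs.wellSeparated {s : ℝ} {v w : SplitTree} {L : List (Finset Plane × Finset Plane)}
    (hL : FindPairs s v w L) {X : Finset Plane × Finset Plane} (hX : X ∈ L) :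
    WellSeparated s X.1 X.2 ∧ X.1 ⊆ v.pts ∧ X.2 ⊆ w.pts := by
  induction hL with
  | separated h =>
    rw [List.mem_singleton] at hX
    subst hX
    exact ⟨h, subset_rfl, subset_rfl⟩
  | splitRight _ _ _ _ ih1 ih2 =>
    rcases List.mem_append.1 hX with hX | hX
    · exact (ih1 hX).imp_right (.imp_right fun h => h.trans (SplitTree.pts_left_subset _ _))
    · exact (ih2 hX).imp_right (.imp_right fun h => h.trans (SplitTree.pts_right_subset _ _))
  | splitLeft _ _ _ _ ih1 ih2 =>
    rcases List.mem_append.1 hX with hX | hX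
    · exact (ih1 hX).imp_right (.imp_left fun h => h.trans (SplitTree.pts_left_subset _ _))
    · exact (ih2 hX).imp_right (.imp_left fun h => h.trans (SplitTree.pts_right_subset _ _))

lemma ComputeWSPD.exists_mem {s : ℝ} {T : SplitTree} {L : List (Finset Plane × Finset Plane)}
    (hL : ComputeWSPD s T L) {p q : Plane} (hp : p ∈ T.pts) (hq : q ∈ T.pts) (hpq : p ≠ q) :
    ∃ X ∈ L, (p ∈ X.1 ∧ q ∈ X.2) ∨ (q ∈ X.1 ∧ p ∈ X.2) := by
  induction hL with
  | leaf x =>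
    exact absurd ((Finset.mem_singleton.1 hp).trans (Finset.mem_singleton.1 hq).symm) hpq
  | node hF _ _ ih1 ih2 =>
    simp only [List.mem_append]
    rcases Finset.mem_union.1 hp with hp | hp <;> rcases Finset.mem_union.1 hq with hq | hq
    · obtain ⟨X, hX, h⟩ := ih1 hp hq
      exact ⟨X, Or.inl (Or.inr hX), h⟩
    · obtain ⟨X, hX, h⟩ := hF.exists_mem hp hq
      exact ⟨X, Or.inl (Or.inl hX), Or.inl h⟩
    · obtain ⟨X, hX, h⟩ := hF.exists_mem hq hp
      exact ⟨X, Or.inl (Or.inl hX), Or.inr h⟩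
    · obtain ⟨X, hX, h⟩ := ih2 hp hq
      exact ⟨X, Or.inr hX, h⟩

lemma ComputeWSPD.wellSeparated {s : ℝ} {T : SplitTree}
    {L : List (Finset Plane × Finset Plane)} (hL : ComputeWSPD s T L)
    {X : Finset Plane × Finset Plane} (hX : X ∈ L) :
    WellSeparated s X.1 X.2 ∧ X.1 ⊆ T.pts ∧ X.2 ⊆ T.pts := by
  induction hL with
  | leaf x => cases hX
  | node hF _ _ ih1 ih2 =>
    rw [List.mem_append, List.mem_append] at hX
    rcases hX with (hX | hX) | hX
    · exact (hF.wellSeparated hX).imp_right (.imp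
        (fun h => h.trans (SplitTree.pts_left_subset _ _))
        (fun h => h.trans (SplitTree.pts_right_subset _ _)))
    · exact (ih1 hX).imp_right (.imp
        (fun h => h.trans (SplitTree.pts_left_subset _ _))
        (fun h => h.trans (SplitTree.pts_left_subset _ _)))
    · exact (ih2 hX).imp_right (.imp
        (fun h => h.trans (SplitTree.pts_right_subset _ _))
        (fun h => h.trans (SplitTree.pts_right_subset _ _)))

/-! ### The spanner given by a well-separated pair decomposition -/

/-- The spanner given by a well-separated pair decomposition has stretch `t`: the edge of a
well-separated pair is extended by two paths between points of the same set, which are much closer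
to each other than the given points. -/
theorem hasWalk_of_forall_exists_wellSeparated {t : ℝ} (ht : 1 < t) {S : Finset Plane}
    {W : SimpleGraph Plane}
    (h : ∀ p ∈ S, ∀ q ∈ S, p ≠ q → ∃ A B : Finset Plane,
      WellSeparated (4 * (t + 1) / (t - 1)) A B ∧ A ⊆ S ∧ B ⊆ S ∧ p ∈ A ∧ q ∈ B ∧
        ∃ a ∈ A, ∃ b ∈ B, W.Adj a b)
    {p q : Plane} (hp : p ∈ S) (hq : q ∈ S) : HasWalk W (t * dist p q) p q := by
  classical
  -- induction on the number of pairs of points of `S` with a smaller distance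
  induction hn : ((S ×ˢ S).filter fun e => dist e.1 e.2 < dist p q).card using
    Nat.strong_induction_on generalizing p q with
  | _ n ih =>
  have hrec : ∀ x ∈ S, ∀ y ∈ S, dist x y < dist p q → HasWalk W (t * dist x y) x y := by
    intro x hx y hy hxy
    refine ih _ ?_ hx hy rfl
    rw [← hn]
    refine Finset.card_lt_card (Finset.ssubset_iff_of_subset ?_ |>.2 ⟨(x, y), ?_, ?_⟩)
    · intro e he
      rw [Finset.mem_filter] at he ⊢
      exact ⟨he.1, he.2.trans hxy⟩
    · simp [hx, hy, hxy]
    · simp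
  rcases eq_or_ne p q with rfl | hpq
  · exact HasWalk.refl (by simp)
  obtain ⟨A, B, ⟨ca, cb, r, hr, hA, hB, hdisj, hsep⟩, hAS, hBS, hpA, hqB, a, haA, b, hbB, hab⟩ :=
    h p hp q hq hpq
  have hpca := Metric.mem_closedBall.1 (hA (mem_bbox hpA))
  have haca := Metric.mem_closedBall.1 (hA (mem_bbox haA))
  have hqcb := Metric.mem_closedBall.1 (hB (mem_bbox hqB))
  have hbcb := Metric.mem_closedBall.1 (hB (mem_bbox hbB))
  set s := 4 * (t + 1) / (t - 1) with hs
  have hs' : s * (t - 1) = 4 * (t + 1) := div_mul_cancel₀ _ (by linarith)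
  have hs4 : 4 < s := by
    rw [hs, lt_div_iff₀ (by linarith)]
    linarith
  have h1 : dist p a ≤ 2 * r := by linarith [dist_triangle_right p a ca]
  have h2 : dist b q ≤ 2 * r := by linarith [dist_triangle_right b q cb]
  have h3 : dist ca cb ≤ dist p q + 2 * r := by
    linarith [dist_triangle4 ca p q cb, dist_comm ca p]
  have h4 : dist a b ≤ dist p q + 4 * r := by
    linarith [dist_triangle4 a p q b, dist_comm a p, dist_comm q b]
  have hsr : s * r ≤ dist p q := by linarith
  have hpos := dist_pos.2 hpq
  have hlt : 2 * r < dist p q := by nlinarith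
  refine (((hrec p hp a (hAS haA) (h1.trans_lt hlt)).trans (HasWalk.of_adj hab)).trans
    (hrec b (hBS hbB) q hq (h2.trans_lt hlt))).mono ?_
  have h5 : 4 * (t + 1) * r ≤ (t - 1) * dist p q := by
    calc 4 * (t + 1) * r = (t - 1) * (s * r) := by rw [← hs']; ring
      _ ≤ _ := mul_le_mul_of_nonneg_left hsr (by linarith)
  nlinarith [mul_le_mul_of_nonneg_left h1 (by linarith : (0 : ℝ) ≤ t),
    mul_le_mul_of_nonneg_left h2 (by linarith : (0 : ℝ) ≤ t)]

lemma WellSeparated.ne {s : ℝ} {A B : Finset Plane} (h : WellSeparated s A B) {a b : Plane}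
    (ha : a ∈ A) (hb : b ∈ B) : a ≠ b := by
  rintro rfl
  obtain ⟨x, y, r, -, h1, h2, h3, -⟩ := h
  have h1 := Metric.mem_closedBall.1 (h1 (mem_bbox ha))
  have h2 := Metric.mem_closedBall.1 (h2 (mem_bbox hb))
  linarith [dist_triangle_left x y a]

/-- The spanner on the leaders: it has stretch `t`, its edges join points of `S`, and their number
is linear. -/
theorem IsWSPDSpanner.spec {t : ℝ} (ht : 1 < t) {S : Finset Plane} {W : SimpleGraph Plane}
    (h : IsWSPDSpanner t S W) :
    (∀ p ∈ S, ∀ q ∈ S, HasWalk W (t * dist p q) p q) ∧ (∀ p q, W.Adj p q → p ∈ S ∧ q ∈ S) ∧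
      ∃ E : Finset (Sym2 Plane), W.edgeSet ⊆ E ∧
        E.card ≤ wspdConst (4 * (t + 1) / (t - 1)) * S.card := by
  classical
  rcases h with ⟨rfl, rfl⟩ | ⟨T, hT, rfl, L, hL, a, b, hab, rfl⟩
  · exact ⟨by simp, by simp, ∅, by simp⟩
  have hadj : ∀ A ∈ L, (SimpleGraph.fromEdgeSet {e | ∃ A ∈ L, e = s(a A, b A)}).Adj (a A) (b A) :=
    fun A hA => (SimpleGraph.fromEdgeSet_adj _).2 ⟨⟨A, hA, rfl⟩,
      (hL.wellSeparated hA).1.ne (hab A hA).1 (hab A hA).2⟩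
  refine ⟨fun p hp q hq => hasWalk_of_forall_exists_wellSeparated ht ?_ hp hq, ?_,
    L.toFinset.image fun A => s(a A, b A), ?_, ?_⟩
  · intro p hp q hq hpq
    obtain ⟨X, hX, h⟩ := hL.exists_mem hp hq hpq
    obtain ⟨hsep, h1, h2⟩ := hL.wellSeparated hX
    rcases h with h | h
    · exact ⟨X.1, X.2, hsep, h1, h2, h.1, h.2, _, (hab X hX).1, _, (hab X hX).2, hadj X hX⟩
    · exact ⟨X.2, X.1, hsep.symm, h2, h1, h.2, h.1, _, (hab X hX).2, _, (hab X hX).1,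
        (hadj X hX).symm⟩
  · intro p q hpq
    obtain ⟨⟨A, hA, he⟩, -⟩ := (SimpleGraph.fromEdgeSet_adj _).1 hpq
    obtain ⟨-, h1, h2⟩ := hL.wellSeparated hA
    have ha := h1 (hab A hA).1
    have hb := h2 (hab A hA).2
    rcases Sym2.eq_iff.1 he with ⟨rfl, rfl⟩ | ⟨rfl, rfl⟩
    · exact ⟨ha, hb⟩
    · exact ⟨hb, ha⟩
  · intro e he
    rw [SimpleGraph.edgeSet_fromEdgeSet] at he
    obtain ⟨A, hA, rfl⟩ := he.1
    exact Finset.mem_coe.2 (Finset.mem_image.2 ⟨A, List.mem_toFinset.2 hA, rfl⟩)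
  · refine Finset.card_image_le.trans (hL.card_le ?_ hT)
    exact div_nonneg (by linarith) (by linarith)

/-! ### Quadtrees -/

/-- The part of the validity of a quadtree that does not depend on which nodes are subdivided. In
contrast to `QuadTree.Valid`, it treats the root like the other nodes. -/
def QuadTree.IsSound (k : ℕ) : QuadTree → Box → Prop
  | .leaf Q, B => Q.card ≤ k ∧ (Q : Set Plane) ⊆ B.toSet
  | .node child, B => (∀ b c, b ≠ c → Disjoint (child b).pts (child c).pts) ∧
      ∀ b, (child b).IsSound k (B.quadrant b)

lemma QuadTree.ValidBelow.isSound {k : ℕ} {T : QuadTree} {B : Box} (h : T.ValidBelow k B) :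
    T.IsSound k B := by
  induction T generalizing B with
  | leaf Q => exact h
  | node child ih => exact ⟨h.2.1, fun b => ih b (h.2.2 b)⟩

lemma QuadTree.Valid.isSound {k : ℕ} {T : QuadTree} {B : Box} (h : T.Valid k B) :
    T.IsSound k B := by
  cases T with
  | leaf Q => exact h
  | node child => exact ⟨h.1, fun b => (h.2 b).isSound⟩

namespace QuadTree

variable {k : ℕ} {T : QuadTree} {B : Box} {σ τ : Leaf}

lemma mem_pts_node {child : (Fin 2 → Bool) → QuadTree} {p : Plane} :
    p ∈ (QuadTree.node child).pts ↔ ∃ b, p ∈ (child b).pts := by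
  classical
  simp [pts]

lemma pts_subset_of_mem_leaves (hσ : σ ∈ T.leaves B) : σ.pts ⊆ T.pts := by
  induction T generalizing B with
  | leaf Q => cases hσ; rfl
  | node child ih =>
    obtain ⟨b, hb⟩ := Set.mem_iUnion.1 hσ
    exact fun p hp => mem_pts_node.2 ⟨b, ih b hb hp⟩

lemma exists_mem_leaves {p : Plane} (hp : p ∈ T.pts) (B : Box) : ∃ σ ∈ T.leaves B, p ∈ σ.pts := by
  induction T generalizing B with
  | leaf Q => exact ⟨_, rfl, hp⟩
  | node child ih =>
    obtain ⟨b, hb⟩ := mem_pts_node.1 hp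
    obtain ⟨σ, hσ, h⟩ := ih b hb (B.quadrant b)
    exact ⟨σ, Set.mem_iUnion.2 ⟨b, hσ⟩, h⟩

lemma exists_mem_nonemptyLeaves {p : Plane} (hp : p ∈ T.pts) (B : Box) :
    ∃ σ ∈ T.nonemptyLeaves B, p ∈ σ.pts := by
  obtain ⟨σ, hσ, h⟩ := exists_mem_leaves hp B
  exact ⟨σ, ⟨hσ, p, h⟩, h⟩

lemma IsSound.spec_of_mem_leaves (hT : T.IsSound k B) (hσ : σ ∈ T.leaves B) :
    σ.pts.card ≤ k ∧ (σ.pts : Set Plane) ⊆ σ.box.toSet := by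
  induction T generalizing B with
  | leaf Q => cases hσ; exact hT
  | node child ih =>
    obtain ⟨b, hb⟩ := Set.mem_iUnion.1 hσ
    exact ih b (hT.2 b) hb

lemma IsSound.leaf_eq_of_mem_pts (hT : T.IsSound k B) (hσ : σ ∈ T.leaves B) (hτ : τ ∈ T.leaves B)
    {p : Plane} (hpσ : p ∈ σ.pts) (hpτ : p ∈ τ.pts) : σ = τ := by
  induction T generalizing B with
  | leaf Q => cases hσ; cases hτ; rfl
  | node child ih =>
    obtain ⟨b, hb⟩ := Set.mem_iUnion.1 hσ
    obtain ⟨c, hc⟩ := Set.mem_iUnion.1 hτ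
    obtain rfl : b = c := by
      by_contra hbc
      exact Finset.disjoint_left.1 (hT.1 b c hbc) (pts_subset_of_mem_leaves hb hpσ)
        (pts_subset_of_mem_leaves hc hpτ)
    exact ih b (hT.2 b) hb hc

lemma side_quadrant (B : Box) (b : Fin 2 → Bool) (i : Fin 2) :
    (B.quadrant b).side i = B.side i / 2 := by
  simp only [Box.side, Box.quadrant, Box.mid]
  cases b i <;> simp <;> ring

/-- The leaf cells have the aspect ratio of the root cell. -/
lemma side_le_of_mem_leaves {ρ : ℝ} (hB : ∀ i j, B.side i ≤ ρ * B.side j) (hσ : σ ∈ T.leaves B)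
    (i j : Fin 2) : σ.box.side i ≤ ρ * σ.box.side j := by
  induction T generalizing B with
  | leaf Q => cases hσ; exact hB i j
  | node child ih =>
    obtain ⟨b, hb⟩ := Set.mem_iUnion.1 hσ
    refine ih b (fun i j => ?_) hb
    rw [side_quadrant, side_quadrant]
    linarith [hB i j]

/-- The root cell has nonnegative sides if there is a point in some leaf cell. -/
lemma IsSound.side_nonneg (hT : T.IsSound k B) (hne : T.pts.Nonempty) (i : Fin 2) :
    0 ≤ B.side i := by
  induction T generalizing B with
  | leaf Q =>
    obtain ⟨p, hp⟩ := hne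
    have := hT.2 hp i
    exact sub_nonneg.2 (this.1.trans this.2)
  | node child ih =>
    obtain ⟨p, hp⟩ := hne
    obtain ⟨b, hb⟩ := mem_pts_node.1 hp
    have := ih b (hT.2 b) ⟨p, hb⟩
    rw [side_quadrant] at this
    linarith

lemma halfOpen_quadrant_subset (B : Box) (b : Fin 2 → Bool) :
    (B.quadrant b).halfOpen ⊆ B.halfOpen := by
  intro c hc i
  have := hc i
  simp only [Box.quadrant, Box.mid] at this
  cases hb : b i <;> simp [hb] at this <;> constructor <;> linarith

lemma halfOpen_subset_of_mem_leaves (hσ : σ ∈ T.leaves B) :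
    σ.box.halfOpen ⊆ B.halfOpen := by
  induction T generalizing B with
  | leaf Q => cases hσ; rfl
  | node child ih =>
    obtain ⟨b, hb⟩ := Set.mem_iUnion.1 hσ
    exact (ih b hb).trans (halfOpen_quadrant_subset B b)

lemma leaf_eq_of_mem_halfOpen (hσ : σ ∈ T.leaves B) (hτ : τ ∈ T.leaves B) {c : Fin 2 → ℝ}
    (hcσ : c ∈ σ.box.halfOpen) (hcτ : c ∈ τ.box.halfOpen) : σ = τ := by
  induction T generalizing B with
  | leaf Q => cases hσ; cases hτ; rfl
  | node child ih =>
    obtain ⟨b, hb⟩ := Set.mem_iUnion.1 hσ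
    obtain ⟨b', hb'⟩ := Set.mem_iUnion.1 hτ
    obtain rfl : b = b' := by
      funext i
      have h := halfOpen_subset_of_mem_leaves hb hcσ i
      have h' := halfOpen_subset_of_mem_leaves hb' hcτ i
      simp only [Box.quadrant] at h h'
      cases hbi : b i <;> cases hbi' : b' i <;> simp [hbi, hbi'] at h h' ⊢ <;> linarith
    exact ih b hb hb'

end QuadTree

/-! ### Greedy extensions of a graph -/

/-- `G'` arises from `G` by an edge between two points of `P` that have no `t`-path in `G`. -/
def AddsEdge (t : ℝ) (P : Finset Plane) (G G' : SimpleGraph Plane) : Prop :=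
  ∃ u ∈ P, ∃ v ∈ P, ¬ HasWalk G (t * dist u v) u v ∧ G' = G ⊔ SimpleGraph.edge u v

/-- `G'` arises from `G` by adding, one after the other, edges between points of `P` that have no
`t`-path when their edge is added; the order of the edges is arbitrary. -/
def IsGreedyExtension (t : ℝ) (P : Finset Plane) : SimpleGraph Plane → SimpleGraph Plane → Prop :=
  Relation.ReflTransGen (AddsEdge t P)

lemma AddsEdge.le {t : ℝ} {P : Finset Plane} {G G' : SimpleGraph Plane} (h : AddsEdge t P G G') :
    G ≤ G' := by
  obtain ⟨u, -, v, -, -, rfl⟩ := h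
  exact le_sup_left

lemma IsGreedyExtension.le {t : ℝ} {P : Finset Plane} {G G' : SimpleGraph Plane}
    (h : IsGreedyExtension t P G G') : G ≤ G' := by
  induction h with
  | refl => exact le_rfl
  | tail _ h ih => exact ih.trans h.le

/-- If the pairs of points are labelled in such a way that an edge between two points gives
`t`-paths between all pairs with the same label, then a greedy extension adds at most one edge for
each label. -/
theorem IsGreedyExtension.exists_finset {t : ℝ} {P : Finset Plane} {G₀ G : SimpleGraph Plane}
    (hG : IsGreedyExtension t P G₀ G) {ι : Type*} (Λ : Finset ι) (Lab : Plane → Plane → ι → Prop)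
    (h1 : ∀ u ∈ P, ∀ v ∈ P, u ≠ v → ∃ l ∈ Λ, Lab u v l)
    (h2 : ∀ u v u' v' l, Lab u v l → Lab u' v' l → ∀ G, G₀ ≤ G → G.Adj u v →
      HasWalk G (t * dist u' v') u' v') :
    ∃ F : Finset (Sym2 Plane), G.edgeSet ⊆ G₀.edgeSet ∪ F ∧ F.card ≤ Λ.card ∧
      ∀ u v, s(u, v) ∈ F → u ∈ P ∧ v ∈ P := by
  classical
  obtain ⟨F, hF, hFP, hFinj⟩ : ∃ F : Finset (Plane × Plane),
      G.edgeSet ⊆ G₀.edgeSet ∪ F.image (fun e => s(e.1, e.2)) ∧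
      (∀ e ∈ F, e.1 ∈ P ∧ e.2 ∈ P ∧ G.Adj e.1 e.2) ∧
      ∀ e ∈ F, ∀ f ∈ F, ∀ l ∈ Λ, Lab e.1 e.2 l → Lab f.1 f.2 l → e = f := by
    induction hG with
    | refl => exact ⟨∅, by simp, by simp, by simp⟩
    | @tail G₁ G₂ hG₁ hstep ih =>
      obtain ⟨F, hF, hFP, hFinj⟩ := ih
      have hle := hstep.le
      obtain ⟨u, hu, v, hv, hno, rfl⟩ := hstep
      have hle₁ : G₀ ≤ G₁ := IsGreedyExtension.le hG₁
      have huv : u ≠ v := by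
        rintro rfl
        exact hno (HasWalk.refl (by simp))
      have hnew : ∀ e ∈ F, ∀ l, Lab e.1 e.2 l → ¬ Lab u v l := fun e he l hl hl' =>
        hno (h2 _ _ _ _ l hl hl' G₁ hle₁ (hFP e he).2.2)
      refine ⟨insert (u, v) F, ?_, ?_, ?_⟩
      · intro e he
        rw [SimpleGraph.edgeSet_sup, SimpleGraph.edgeSet_edge_of_ne huv] at he
        rcases he with he | he
        · rcases hF he with he | he
          · exact Or.inl he
          · exact Or.inr (Finset.mem_coe.2
              (Finset.image_subset_image (Finset.subset_insert _ _) (Finset.mem_coe.1 he)))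
        · refine Or.inr (Finset.mem_coe.2 (Finset.mem_image.2 ⟨(u, v), by simp, he.symm⟩))
      · intro e he
        rcases Finset.mem_insert.1 he with rfl | he
        · exact ⟨hu, hv, Or.inr (by simp [SimpleGraph.edge_adj, huv])⟩
        · exact ⟨(hFP e he).1, (hFP e he).2.1, hle (hFP e he).2.2⟩
      · intro e he f hf l hl he' hf'
        rcases Finset.mem_insert.1 he with rfl | he <;> rcases Finset.mem_insert.1 hf with rfl | hf
        · rfl
        · exact absurd he' (hnew f hf l hf')
        · exact absurd hf' (hnew e he l he')
        · exact hFinj e he f hf l hl he' hf'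
  refine ⟨F.image fun e => s(e.1, e.2), hF, Finset.card_image_le.trans ?_, fun u v huv => ?_⟩
  · refine card_le_card_of_labels (fun e l => Lab e.1 e.2 l) (fun e he => ?_) hFinj
    obtain ⟨hu, hv, hadj⟩ := hFP e he
    exact h1 _ hu _ hv hadj.ne
  · obtain ⟨e, he, h⟩ := Finset.mem_image.1 huv
    obtain ⟨hu, hv, -⟩ := hFP e he
    rcases Sym2.eq_iff.1 h with ⟨rfl, rfl⟩ | ⟨rfl, rfl⟩
    · exact ⟨hu, hv⟩
    · exact ⟨hv, hu⟩

/-! ### Labels for the merging edges -/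

/-- The situation after the first phases: within every nonempty leaf, and between the leaders of
the nonempty leaves, there are walks in `G` of bounded stretch. -/
structure IsBaseGraph (t t' : ℝ) (T : QuadTree) (R : Box) (leader : Leaf → Plane)
    (G : SimpleGraph Plane) : Prop where
  leader_mem : ∀ σ ∈ T.nonemptyLeaves R, leader σ ∈ σ.pts
  hasWalk_leaf : ∀ σ ∈ T.nonemptyLeaves R, ∀ u ∈ σ.pts, ∀ v ∈ σ.pts,
    HasWalk G (2 * t * dist u v) u v
  hasWalk_leader : ∀ σ ∈ T.nonemptyLeaves R, ∀ τ ∈ T.nonemptyLeaves R,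
    HasWalk G (t' * dist (leader σ) (leader τ)) (leader σ) (leader τ)

/-- The label of the point `u` in a well-separated pair, with respect to the scale `e`: `none` if
the cell of the leaf of `u` has sides of length at most `e`, and otherwise the index of a point of
the lattice of spacing `δ` around `c` that lies in the cell. -/
def HasCellLabel (T : QuadTree) (R : Box) (c : Plane) (e δ : ℝ) (u : Plane) :
    Option (Fin 2 → ℤ) → Prop
  | none => ∃ σ ∈ T.nonemptyLeaves R, u ∈ σ.pts ∧ σ.box.maxSide ≤ e
  | some j => ∃ σ ∈ T.nonemptyLeaves R, u ∈ σ.pts ∧ latticePoint c δ j ∈ σ.box.halfOpen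

/-- A cell that is large compared to the disk of a well-separated pair contains one of `25` lattice
points if it meets the disk. -/
lemma exists_hasCellLabel {k : ℕ} {T : QuadTree} {R : Box} (hT : T.IsSound k R) {ρ δ r : ℝ}
    (hρ : 1 ≤ ρ) (hR : ∀ i j, R.side i ≤ ρ * R.side j) (hδ : 0 < δ) (hr : r ≤ δ) {c u : Plane}
    (hu : u ∈ T.pts) (huc : dist u c ≤ r) :
    ∃ a ∈ Finset.insertNone (latticeBlock 2), HasCellLabel T R c (2 * ρ * δ) δ u a := by
  obtain ⟨σ, hσ, huσ⟩ := QuadTree.exists_mem_nonemptyLeaves hu R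
  rcases le_or_gt σ.box.maxSide (2 * ρ * δ) with h | h
  · exact ⟨none, by simp, σ, hσ, huσ, h⟩
  · have hside : ∀ i, δ < σ.box.side i := by
      intro i
      have h1 : σ.box.maxSide ≤ ρ * σ.box.side i :=
        Box.maxSide_le fun j => QuadTree.side_le_of_mem_leaves hR hσ.1 j i
      have h2 : ρ * (2 * δ) < ρ * σ.box.side i := by linarith
      linarith [lt_of_mul_lt_mul_left h2 (by linarith)]
    obtain ⟨j, hj, hj'⟩ := exists_latticePoint_mem_halfOpen hδ hside
      ((hT.spec_of_mem_leaves hσ.1).2 huσ) (N := 2) (ρ := r) (by push_cast; linarith)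
      fun i => (abs_sub_le_dist u c i).trans huc
    exact ⟨some j, by simpa using hj, σ, hσ, huσ, hj'⟩

/-- Points with the same label are joined by a short walk: through the leaders of their small
cells, or within their common large cell. -/
lemma HasCellLabel.hasWalk {k : ℕ} {t t' : ℝ} (ht : 1 < t) (htt' : t ≤ t') {T : QuadTree} {R : Box}
    (hT : T.IsSound k R) {leader : Leaf → Plane} {G : SimpleGraph Plane}
    (hG : IsBaseGraph t t' T R leader G) {c : Plane} {e δ r : ℝ} (he : 0 ≤ e) (hr : 2 * r ≤ e)
    {u v : Plane} {a : Option (Fin 2 → ℤ)} (hu : HasCellLabel T R c e δ u a)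
    (hv : HasCellLabel T R c e δ v a) (huc : dist u c ≤ r) (hvc : dist v c ≤ r) :
    HasWalk G (16 * t' * e) u v := by
  have huv : dist u v ≤ e := by linarith [dist_triangle_right u v c]
  have ht'e : 0 ≤ t' * e := mul_nonneg (by linarith) he
  have hte : t * e ≤ t' * e := mul_le_mul_of_nonneg_right htt' he
  cases a with
  | none =>
    obtain ⟨σ, hσ, huσ, hσe⟩ := hu
    obtain ⟨τ, hτ, hvτ, hτe⟩ := hv
    have hdiam : ∀ σ ∈ T.nonemptyLeaves R, σ.box.maxSide ≤ e → ∀ x ∈ σ.pts, ∀ y ∈ σ.pts,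
        dist x y ≤ 2 * e := by
      intro σ hσ hσe x hx y hy
      refine dist_le_of_coord fun i => ?_
      have hx := (hT.spec_of_mem_leaves hσ.1).2 hx i
      have hy := (hT.spec_of_mem_leaves hσ.1).2 hy i
      have hs := σ.box.side_le_maxSide i
      unfold Box.side at hs
      rw [abs_le]
      constructor <;> linarith
    have h1 := hdiam σ hσ hσe _ huσ _ (hG.leader_mem σ hσ)
    have h2 := hdiam τ hτ hτe _ (hG.leader_mem τ hτ) _ hvτ
    have h3 : dist (leader σ) (leader τ) ≤ 5 * e := by
      linarith [dist_triangle4 (leader σ) u v (leader τ), dist_comm u (leader σ),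
        dist_comm v (leader τ)]
    refine (((hG.hasWalk_leaf σ hσ _ huσ _ (hG.leader_mem σ hσ)).trans
      (hG.hasWalk_leader σ hσ τ hτ)).trans
      (hG.hasWalk_leaf τ hτ _ (hG.leader_mem τ hτ) _ hvτ)).mono ?_
    have := mul_le_mul_of_nonneg_left h1 (by linarith : 0 ≤ 2 * t)
    have := mul_le_mul_of_nonneg_left h2 (by linarith : 0 ≤ 2 * t)
    have := mul_le_mul_of_nonneg_left h3 (by linarith : 0 ≤ t')
    linarith
  | some j =>
    obtain ⟨σ, hσ, huσ, hσj⟩ := hu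
    obtain ⟨τ, hτ, hvτ, hτj⟩ := hv
    obtain rfl := QuadTree.leaf_eq_of_mem_halfOpen hσ.1 hτ.1 hσj hτj
    refine (hG.hasWalk_leaf σ hσ u huσ v hvτ).mono ?_
    have := mul_le_mul_of_nonneg_left huv (by linarith : 0 ≤ 2 * t)
    linarith

/-- The points of the quadtree have labels as in `IsGreedyExtension.exists_finset`, and their
number is linear. A label consists of a well-separated pair, for a large separation ratio, of its
orientation, and of the labels of the two points in the pair. -/
theorem exists_labels {t t' : ℝ} (ht : 1 < t) (htt' : t ≤ t') (ρ : ℝ) :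
    ∃ C : ℕ, ∀ (k : ℕ) (T : QuadTree) (R : Box) (leader : Leaf → Plane) (G₀ : SimpleGraph Plane),
      T.IsSound k R → (∀ i j, R.side i ≤ ρ * R.side j) → IsBaseGraph t t' T R leader G₀ →
      ∃ (ι : Type) (Λ : Finset ι) (Lab : Plane → Plane → ι → Prop),
        Λ.card ≤ C * T.pts.card ∧
        (∀ u ∈ T.pts, ∀ v ∈ T.pts, u ≠ v → ∃ l ∈ Λ, Lab u v l) ∧
        ∀ u v u' v' l, Lab u v l → Lab u' v' l → ∀ G, G₀ ≤ G → G.Adj u v →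
          HasWalk G (t * dist u' v') u' v' := by
  classical
  -- Cells are small at scale `D` if their sides are at most `ε D`, and the disks of a pair at
  -- distance `D` have radius at most `θ D`.
  set ρ' := max ρ 1 with hρ'
  have hρ1 : 1 ≤ ρ' := le_max_right _ _
  set ε := (t - 1) / (36 * t') with hε
  have hεt : 36 * t' * ε = t - 1 := mul_div_cancel₀ _ (by linarith)
  have hεpos : 0 < ε := div_pos (by linarith) (by linarith)
  have hε1 : ε ≤ 1 / 36 := by
    rw [hε, div_le_div_iff₀ (by linarith) (by norm_num)]
    linarith
  set θ := ε / (2 * ρ') with hθ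
  have hθpos : 0 < θ := div_pos hεpos (by linarith)
  have hθε : 2 * ρ' * θ = ε := mul_div_cancel₀ _ (by linarith)
  have hθ2 : 2 * θ ≤ ε := by nlinarith
  set s := 1 / θ - 2 with hs
  have hsθ : (s + 2) * θ = 1 := by
    rw [hs, sub_add_cancel]
    exact one_div_mul_cancel hθpos.ne'
  have hs0 : 0 ≤ s := by nlinarith
  refine ⟨wspdConst s * (2 * (Finset.insertNone (latticeBlock 2)).card ^ 2),
    fun k T R leader G₀ hT hR hG₀ => ?_⟩
  rcases T.pts.eq_empty_or_nonempty with hempty | hne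
  · exact ⟨Unit, ∅, fun _ _ _ => False, by simp, by simp [hempty], by simp⟩
  have hR' : ∀ i j, R.side i ≤ ρ' * R.side j := by
    intro i j
    exact (hR i j).trans (mul_le_mul_of_nonneg_right (le_max_left _ _) (hT.side_nonneg hne j))
  obtain ⟨S, hS, hSpts⟩ := exists_splitTree hne
  obtain ⟨L, hL⟩ := exists_computeWSPD s hS
  have hsep : ∀ X ∈ L, ∃ (c₁ c₂ : Plane) (r : ℝ),
      (∀ x ∈ X.1, dist x c₁ ≤ r) ∧ (∀ y ∈ X.2, dist y c₂ ≤ r) ∧ 0 < dist c₁ c₂ ∧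
        r ≤ θ * dist c₁ c₂ := by
    intro X hX
    obtain ⟨c₁, c₂, r, hr, h1, h2, h3, h4⟩ := (hL.wellSeparated hX).1
    refine ⟨c₁, c₂, r, fun x hx => h1 (mem_bbox hx), fun y hy => h2 (mem_bbox hy), by linarith, ?_⟩
    calc r = θ * ((s + 2) * r) := by rw [← mul_assoc, mul_comm θ, hsθ, one_mul]
      _ ≤ θ * dist c₁ c₂ := mul_le_mul_of_nonneg_left (by linarith) hθpos.le
  choose! c₁ c₂ r hr₁ hr₂ hD hr using hsep
  let D X := dist (c₁ X) (c₂ X)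
  let J : Finset (Option (Fin 2 → ℤ)) := Finset.insertNone (latticeBlock 2)
  let Cell (c : Plane) (d : ℝ) (u : Plane) (a : Option (Fin 2 → ℤ)) : Prop :=
    HasCellLabel T R c (ε * d) (θ * d) u a
  let Pair (X : Finset Plane × Finset Plane) (a b : Option (Fin 2 → ℤ)) (x y : Plane) : Prop :=
    X ∈ L ∧ x ∈ X.1 ∧ y ∈ X.2 ∧ Cell (c₁ X) (D X) x a ∧ Cell (c₂ X) (D X) y b
  let Lab (u v : Plane)
      (l : (Finset Plane × Finset Plane) × Bool × Option (Fin 2 → ℤ) × Option (Fin 2 → ℤ)) : Prop :=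
    bif l.2.1 then Pair l.1 l.2.2.1 l.2.2.2 u v else Pair l.1 l.2.2.1 l.2.2.2 v u
  have hexists : ∀ X ∈ L, ∀ x ∈ X.1, ∀ y ∈ X.2, ∃ a ∈ J, ∃ b ∈ J, Pair X a b x y := by
    intro X hX x hx y hy
    obtain ⟨-, h1, h2⟩ := hL.wellSeparated hX
    rw [hSpts] at h1 h2
    have hδ : 0 < θ * D X := mul_pos hθpos (hD X hX)
    have he : 2 * ρ' * (θ * D X) = ε * D X := by rw [← mul_assoc, hθε]
    obtain ⟨a, ha, ha'⟩ := exists_hasCellLabel hT hρ1 hR' hδ (hr X hX) (h1 hx) (hr₁ X hX x hx)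
    obtain ⟨b, hb, hb'⟩ := exists_hasCellLabel hT hρ1 hR' hδ (hr X hX) (h2 hy) (hr₂ X hX y hy)
    rw [he] at ha' hb'
    exact ⟨a, ha, b, hb, hX, hx, hy, ha', hb'⟩
  have hpair : ∀ X a b x y x' y', Pair X a b x y → Pair X a b x' y' → ∀ G, G₀ ≤ G → G.Adj x y →
      HasWalk G (t * dist x' y') x' y' := by
    rintro X a b x y x' y' ⟨hX, hx, hy, hxa, hyb⟩ ⟨-, hx', hy', hxa', hyb'⟩ G hG hadj
    have hDX : 0 < D X := hD X hX
    have hrX : r X ≤ θ * D X := hr X hX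
    have he : 0 ≤ ε * D X := by positivity
    have hre : 2 * r X ≤ ε * D X := by nlinarith
    have hxx := hxa'.hasWalk ht htt' hT hG₀ he hre hxa (hr₁ X hX x' hx') (hr₁ X hX x hx)
    have hyy := hyb.hasWalk ht htt' hT hG₀ he hre hyb' (hr₂ X hX y hy) (hr₂ X hX y' hy')
    refine (((hxx.mono_graph hG).trans (HasWalk.of_adj hadj)).trans (hyy.mono_graph hG)).mono ?_
    have h1 : dist x y ≤ D X + 2 * r X := by
      linarith [dist_triangle4 x (c₁ X) (c₂ X) y, hr₁ X hX x hx, hr₂ X hX y hy,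
        dist_comm y (c₂ X)]
    have h2 : D X - 2 * r X ≤ dist x' y' := by
      linarith [dist_triangle4 (c₁ X) x' y' (c₂ X), hr₁ X hX x' hx', hr₂ X hX y' hy',
        dist_comm x' (c₁ X)]
    have h3 : t * (D X - ε * D X) ≤ t * dist x' y' :=
      mul_le_mul_of_nonneg_left (by linarith) (by linarith)
    have h4 : 36 * t' * (ε * D X) = t * D X - D X := by
      rw [← mul_assoc, hεt]
      ring
    have h5 : t * (ε * D X) ≤ t' * (ε * D X) := mul_le_mul_of_nonneg_right htt' he
    have h6 : 1 * (ε * D X) ≤ t' * (ε * D X) := mul_le_mul_of_nonneg_right (by linarith) he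
    linarith
  refine ⟨_, L.toFinset ×ˢ Finset.univ ×ˢ J ×ˢ J, Lab, ?_, ?_, ?_⟩
  · have := hL.card_le hs0 hS
    rw [hSpts] at this
    simp only [Finset.card_product, Finset.card_univ, Fintype.card_bool]
    calc L.toFinset.card * (2 * (J.card * J.card))
        ≤ wspdConst s * T.pts.card * (2 * (J.card * J.card)) := Nat.mul_le_mul_right _ this
      _ = _ := by ring
  · intro u hu v hv huv
    rw [← hSpts] at hu hv
    obtain ⟨X, hX, ⟨h1, h2⟩ | ⟨h1, h2⟩⟩ := hL.exists_mem hu hv huv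
    · obtain ⟨a, ha, b, hb, h⟩ := hexists X hX u h1 v h2
      exact ⟨(X, true, a, b), by simp [hX, ha, hb], h⟩
    · obtain ⟨a, ha, b, hb, h⟩ := hexists X hX v h1 u h2
      exact ⟨(X, false, a, b), by simp [hX, ha, hb], h⟩
  · rintro u v u' v' ⟨X, o, a, b⟩ h h' G hG hadj
    cases o with
    | true => exact hpair X a b u v u' v' h h' G hG hadj
    | false =>
      rw [dist_comm]
      exact (hpair X a b v u v' u' h h' G hG hadj.symm).symm

/-! ### The local greedy spanners -/

lemma graphDist_anti {G G' : SimpleGraph Plane} (h : G ≤ G') (u v : Plane) :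
    graphDist G' u v ≤ graphDist G u v :=
  le_iInf fun p => (iInf_le _ (p.mapLe h)).trans_eq (by rw [walkLength_mapLe])

lemma graphDist_comm (G : SimpleGraph Plane) (u v : Plane) : graphDist G u v = graphDist G v u := by
  have : ∀ u v, graphDist G u v ≤ graphDist G v u := fun u v =>
    le_iInf fun p => (iInf_le _ p.reverse).trans_eq (by rw [walkLength_reverse])
  exact le_antisymm (this u v) (this v u)

lemma HasWalk.graphDist_le {G : SimpleGraph Plane} {c : ℝ} {u v : Plane} (h : HasWalk G c u v) :
    graphDist G u v ≤ ENNReal.ofReal c := by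
  obtain ⟨p, hp⟩ := h
  exact (iInf_le _ p).trans (ENNReal.ofReal_le_ofReal hp)

lemma walkLength_nonneg {G : SimpleGraph Plane} {u v : Plane} (p : G.Walk u v) :
    0 ≤ walkLength p :=
  List.sum_nonneg (by simp)

lemma hasWalk_of_graphDist_lt {G : SimpleGraph Plane} {c : ℝ} {u v : Plane}
    (h : graphDist G u v < ENNReal.ofReal c) : HasWalk G c u v := by
  obtain ⟨p, hp⟩ := iInf_lt_iff.1 h
  exact ⟨p, ((ENNReal.ofReal_lt_ofReal_iff_of_nonneg (walkLength_nonneg p)).1 hp).le⟩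

namespace FGState

lemma graph_le_step (t : ℝ) (s : FGState) (e : Plane × Plane) : s.graph ≤ (s.step t e).graph := by
  unfold step
  split_ifs
  · exact le_sup_left
  · exact le_rfl
  · exact le_rfl

lemma graphDist_le_refresh {s : FGState} (h : ∀ x y, graphDist s.graph x y ≤ s.weight x y)
    (p x y : Plane) : graphDist s.graph x y ≤ s.refresh p x y := by
  unfold refresh
  split_ifs with h1 h2
  · rw [h1]
  · rw [h2, graphDist_comm]
  · exact h x y

/-- The entries of the weight matrix may be outdated, but as the graph only grows they remain upper
bounds for the distances. -/
lemma graphDist_le_weight_step (t : ℝ) {s : FGState}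
    (h : ∀ x y, graphDist s.graph x y ≤ s.weight x y) (e : Plane × Plane) (x y : Plane) :
    graphDist (s.step t e).graph x y ≤ (s.step t e).weight x y := by
  unfold step
  split_ifs
  · exact (graphDist_anti le_sup_left x y).trans (graphDist_le_refresh h _ x y)
  · exact graphDist_le_refresh h _ x y
  · exact h x y

lemma graphDist_step_le {t : ℝ} (ht : 1 ≤ t) {s : FGState}
    (h : ∀ x y, graphDist s.graph x y ≤ s.weight x y) {e : Plane × Plane} (he : e.1 ≠ e.2) :
    graphDist (s.step t e).graph e.1 e.2 ≤ ENNReal.ofReal (t * dist e.1 e.2) := by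
  unfold step
  split_ifs with h1 h2
  · have hadj : (s.graph ⊔ SimpleGraph.edge e.1 e.2).Adj e.1 e.2 :=
      Or.inr (by simp [SimpleGraph.edge_adj, he])
    exact ((HasWalk.of_adj hadj).mono (le_mul_of_one_le_left dist_nonneg ht)).graphDist_le
  · exact (graphDist_le_refresh h _ _ _).trans (not_lt.1 h2)
  · exact (h _ _).trans (not_lt.1 h1)

lemma graph_le_foldl (t : ℝ) (L : List (Plane × Plane)) (s : FGState) :
    s.graph ≤ (L.foldl (step t) s).graph := by
  induction L generalizing s with
  | nil => exact le_rfl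
  | cons e L ih => exact (s.graph_le_step t e).trans (ih _)

lemma graphDist_foldl_le {t : ℝ} (ht : 1 ≤ t) (L : List (Plane × Plane)) {s : FGState}
    (h : ∀ x y, graphDist s.graph x y ≤ s.weight x y) {e : Plane × Plane} (heL : e ∈ L)
    (he : e.1 ≠ e.2) :
    graphDist (L.foldl (step t) s).graph e.1 e.2 ≤ ENNReal.ofReal (t * dist e.1 e.2) := by
  induction L generalizing s with
  | nil => cases heL
  | cons f L ih =>
    rcases List.mem_cons.1 heL with rfl | heL
    · exact (graphDist_anti (graph_le_foldl t L _) _ _).trans (graphDist_step_le ht h he)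
    · exact ih (graphDist_le_weight_step t h f) heL

lemma adj_foldl {t : ℝ} {L : List (Plane × Plane)} {s : FGState} {u v : Plane}
    (h : (L.foldl (step t) s).graph.Adj u v) :
    s.graph.Adj u v ∨ s(u, v) ∈ L.map fun e => s(e.1, e.2) := by
  induction L generalizing s with
  | nil => exact Or.inl h
  | cons f L ih =>
    rw [List.map_cons, List.mem_cons]
    rcases ih h with h | h
    · unfold step at h
      split_ifs at h
      · rcases h with h | h
        · exact Or.inl h
        · exact Or.inr (Or.inl (Sym2.eq_iff.2 ((SimpleGraph.edge_adj ..).1 h).1))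
      · exact Or.inl h
      · exact Or.inl h
    · exact Or.inr (Or.inr h)

end FGState

/-- The local greedy spanner joins points of `Q`, and its stretch is bounded. The factor `2` makes
up for the fact that an infimum over infinitely many walks is not evidently attained. -/
theorem IsFGGreedy.spec {t : ℝ} (ht : 1 ≤ t) {Q : Finset Plane} {H : SimpleGraph Plane}
    (h : IsFGGreedy t Q H) :
    (∀ u v, H.Adj u v → u ∈ Q ∧ v ∈ Q) ∧
      ∀ u ∈ Q, ∀ v ∈ Q, HasWalk H (2 * t * dist u v) u v := by
  obtain ⟨L, -, hL, -, rfl⟩ := h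
  refine ⟨fun u v huv => ?_, fun u hu v hv => ?_⟩
  · rcases FGState.adj_foldl huv with h | h
    · exact h.elim
    · have := (hL u v).1 h
      exact ⟨this.1, this.2.1⟩
  · rcases eq_or_ne u v with rfl | huv
    · exact HasWalk.refl (by simp)
    have hpos := dist_pos.2 huv
    obtain ⟨e, he, heq⟩ := List.mem_map.1 ((hL u v).2 ⟨hu, hv, huv⟩)
    have hne : e.1 ≠ e.2 := by
      rcases Sym2.eq_iff.1 heq with ⟨h1, h2⟩ | ⟨h1, h2⟩ <;> rw [h1, h2]
      · exact huv
      · exact huv.symm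
    have hinit : ∀ x y, graphDist (⟨⊥, fun _ _ => ⊤⟩ : FGState).graph x y ≤
        (⟨⊥, fun _ _ => ⊤⟩ : FGState).weight x y := fun x y => le_top
    have hd := FGState.graphDist_foldl_le ht L hinit he hne
    have hlt : ENNReal.ofReal (t * dist e.1 e.2) < ENNReal.ofReal (2 * t * dist e.1 e.2) := by
      have : 0 < t * dist e.1 e.2 := mul_pos (by linarith) (dist_pos.2 hne)
      rw [ENNReal.ofReal_lt_ofReal_iff] <;> linarith
    have hw := hasWalk_of_graphDist_lt (hd.trans_lt hlt)
    rcases Sym2.eq_iff.1 heq with ⟨h1, h2⟩ | ⟨h1, h2⟩ <;> rw [h1, h2] at hw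
    · exact hw
    · rw [dist_comm]
      exact hw.symm

/-! ### The loops of the algorithm -/

lemma Loop.rel {α β : Type} {step : α → β → β → Prop} (r : β → β → Prop) (hrefl : ∀ s, r s s)
    (htrans : ∀ s₀ s₁ s₂, r s₀ s₁ → r s₁ s₂ → r s₀ s₂) {L : List α}
    (h : ∀ a ∈ L, ∀ s s', step a s s' → r s s') {s₀ s₁ : β} (hL : Loop step L s₀ s₁) :
    r s₀ s₁ := by
  induction hL with
  | nil s => exact hrefl s
  | cons hstep _ ih =>
    exact htrans _ _ _ (h _ List.mem_cons_self _ _ hstep)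
      (ih fun a ha => h a (List.mem_cons_of_mem _ ha))

/-- A loop whose steps extend a graph greedily extends the graph greedily. -/
lemma Loop.isGreedyExtension {α β : Type} {step : α → β → β → Prop} {t : ℝ} {P : Finset Plane}
    (g : β → SimpleGraph Plane) {L : List α}
    (h : ∀ a ∈ L, ∀ s s', step a s s' → IsGreedyExtension t P (g s) (g s')) {s₀ s₁ : β}
    (hL : Loop step L s₀ s₁) : IsGreedyExtension t P (g s₀) (g s₁) :=
  hL.rel (fun s s' => IsGreedyExtension t P (g s) (g s')) (fun _ => .refl)
    (fun _ _ _ => Relation.ReflTransGen.trans) h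

lemma ForEach.isGreedyExtension {α β : Type} {step : α → β → β → Prop} {t : ℝ} {P : Finset Plane}
    (g : β → SimpleGraph Plane) {S : Set α}
    (h : ∀ a ∈ S, ∀ s s', step a s s' → IsGreedyExtension t P (g s) (g s')) {s₀ s₁ : β}
    (hL : ForEach S step s₀ s₁) : IsGreedyExtension t P (g s₀) (g s₁) := by
  obtain ⟨L, -, hS, hL⟩ := hL
  exact hL.isGreedyExtension g fun a ha => h a ((hS a).1 ha)

lemma MergePair.isGreedyExtension {t : ℝ} {P : Finset Plane} {u v : Plane} {s s' : MergeState}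
    (hu : u ∈ P) (hv : v ∈ P) (h : MergePair t (u, v) s s') :
    IsGreedyExtension t P s.graph s'.graph := by
  cases h with
  | bridged _ => exact .refl
  | greedy _ _ _ => exact .refl
  | shortest _ _ _ _ _ => exact .refl
  | place _ _ _ hno => exact .single ⟨u, hu, v, hv, fun ⟨q, hq⟩ => hno q hq, rfl⟩

lemma GreedyMerge.isGreedyExtension {t : ℝ} {P A B : Finset Plane} {a b : Plane}
    {H H' : SimpleGraph Plane} (hA : A ⊆ P) (hB : B ⊆ P) (h : GreedyMerge t A B a b H H') :
    IsGreedyExtension t P H H' := by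
  obtain ⟨L, -, hL, -, s, hs, rfl⟩ := h
  refine hs.isGreedyExtension MergeState.graph fun e he s s' hstep => ?_
  obtain ⟨hu, hv, -⟩ := (hL e.1 e.2).1 he
  exact hstep.isGreedyExtension (hA hu) (hB hv)

lemma GreedyMergeLight.isGreedyExtension {t : ℝ} {P A B : Finset Plane} {a b : Plane}
    {H H' : SimpleGraph Plane} (hA : A ⊆ P) (hB : B ⊆ P) (h : GreedyMergeLight t A B a b H H') :
    IsGreedyExtension t P H H' := by
  obtain ⟨LA, LB, -, hLA, -, hLB, -, -, s, hs, rfl⟩ := h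
  refine hs.isGreedyExtension MergeState.graph fun u hu s s' hloop => ?_
  refine hloop.isGreedyExtension MergeState.graph fun v hv s s' hstep => ?_
  exact hstep.isGreedyExtension (hA ((hLA u).1 hu)) (hB ((hLB v).1 hv))

lemma MergeLeaves.isGreedyExtension {t : ℝ} {P : Finset Plane}
    {merge : Finset Plane → Finset Plane → Plane → Plane →
      SimpleGraph Plane → SimpleGraph Plane → Prop}
    (hmerge : ∀ {A B a b H H'}, A ⊆ P → B ⊆ P → merge A B a b H H' → IsGreedyExtension t P H H')
    {leader : Leaf → Plane} {σ τ : Leaf} (hσ : σ.pts ⊆ P) (hτ : τ.pts ⊆ P) {s s' : SpannerState}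
    (h : MergeLeaves merge leader σ τ s s') : IsGreedyExtension t P s.graph s'.graph := by
  rcases h with ⟨-, rfl⟩ | ⟨-, -, h⟩
  · exact .refl
  · exact hmerge hσ hτ h

/-- The union of the local spanners contains each of them, and nothing else. -/
lemma ForEach.sup_spec {S : Set Leaf} {r : Leaf → SimpleGraph Plane → Prop} {G : SimpleGraph Plane}
    (h : ForEach S (fun σ G G' => ∃ Hσ, r σ Hσ ∧ G' = G ⊔ Hσ) ⊥ G) :
    (∀ σ ∈ S, ∃ Hσ, r σ Hσ ∧ Hσ ≤ G) ∧
      ∀ u v, G.Adj u v → ∃ σ ∈ S, ∃ Hσ, r σ Hσ ∧ Hσ.Adj u v := by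
  obtain ⟨L, -, hS, hloop⟩ := h
  have key : ∀ {G₀ G : SimpleGraph Plane},
      Loop (fun σ G G' => ∃ Hσ, r σ Hσ ∧ G' = G ⊔ Hσ) L G₀ G →
      G₀ ≤ G ∧ (∀ σ ∈ L, ∃ Hσ, r σ Hσ ∧ Hσ ≤ G) ∧
        ∀ u v, G.Adj u v → G₀.Adj u v ∨ ∃ σ ∈ L, ∃ Hσ, r σ Hσ ∧ Hσ.Adj u v := by
    intro G₀ G hL
    clear hS hloop
    induction hL with
    | nil s => exact ⟨le_rfl, by simp, fun u v h => Or.inl h⟩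
    | cons hstep _ ih =>
      obtain ⟨Hσ, hr, rfl⟩ := hstep
      obtain ⟨h1, h2, h3⟩ := ih
      refine ⟨le_sup_left.trans h1, fun σ hσ => ?_, fun u v huv => ?_⟩
      · rcases List.mem_cons.1 hσ with rfl | hσ
        · exact ⟨Hσ, hr, le_sup_right.trans h1⟩
        · exact h2 σ hσ
      · rcases h3 u v huv with (h | h) | ⟨σ, hσ, h⟩
        · exact Or.inl h
        · exact Or.inr ⟨_, List.mem_cons_self, Hσ, hr, h⟩
        · exact Or.inr ⟨σ, List.mem_cons_of_mem _ hσ, h⟩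
  obtain ⟨-, h2, h3⟩ := key hloop
  refine ⟨fun σ hσ => h2 σ ((hS σ).2 hσ), fun u v huv => ?_⟩
  rcases h3 u v huv with h | ⟨σ, hσ, h⟩
  · exact h.elim
  · exact ⟨σ, (hS σ).1 hσ, h⟩

/-- If every edge joins two points of the same leaf, then there are at most `k` edges per point. -/
lemma exists_finset_of_adj_leaf {k : ℕ} {T : QuadTree} {R : Box} (hT : T.IsSound k R)
    {G : SimpleGraph Plane}
    (hG : ∀ u v, G.Adj u v → ∃ σ ∈ T.nonemptyLeaves R, u ∈ σ.pts ∧ v ∈ σ.pts) :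
    ∃ E : Finset (Sym2 Plane), G.edgeSet ⊆ E ∧ E.card ≤ k * T.pts.card := by
  classical
  have : Inhabited Leaf := ⟨⟨⟨0, 0⟩, ∅⟩⟩
  choose! leafOf hleaf hmem using fun u (hu : u ∈ T.pts) => QuadTree.exists_mem_nonemptyLeaves hu R
  refine ⟨T.pts.biUnion fun u => (leafOf u).pts.image fun v => s(u, v), ?_, ?_⟩
  · rintro ⟨u, v⟩ he
    obtain ⟨σ, hσ, hu, hv⟩ := hG u v he
    have huT := QuadTree.pts_subset_of_mem_leaves hσ.1 hu
    obtain rfl := hT.leaf_eq_of_mem_pts hσ.1 (hleaf u huT).1 hu (hmem u huT)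
    exact Finset.mem_coe.2 (Finset.mem_biUnion.2 ⟨u, huT, Finset.mem_image.2 ⟨v, hv, rfl⟩⟩)
  · rw [mul_comm]
    refine Finset.card_biUnion_le_card_mul _ _ _ fun u hu => ?_
    exact Finset.card_image_le.trans (hT.spec_of_mem_leaves (hleaf u hu).1).1

end FastSpanner

open FastSpanner
theorem theorem1 (t t' : ℝ) (ht : 1 < t) (htt' : t ≤ t') (k h : ℕ) (hk : 1 ≤ k) (hh : 1 ≤ h)
    (ρ : ℝ) :
    ∃ C : ℕ, ∀ (P : Finset Plane) (R : Box),
      (∀ i j, R.side i ≤ ρ * R.side j) →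
      ∀ H : SimpleGraph Plane, IsFastSparseSpanner t t' k h R P H →
        (∀ u v, H.Adj u v → u ∈ P ∧ v ∈ P) ∧
        H.edgeSet.encard ≤ ((C * P.card : ℕ) : ℕ∞) := by
  classical
  obtain ⟨C, hC⟩ := exists_labels ht htt' ρ
  refine ⟨k + wspdConst (4 * (t' + 1) / (t' - 1)) + C, fun P R hR H hH => ?_⟩
  obtain ⟨T, hT, rfl, leader, hleader, H₂, hH₂, S, hS, W, hW, s₄, s₅, h₄, h₅, rfl⟩ := hH
  have hT := hT.isSound
  have hsub : ∀ σ ∈ T.nonemptyLeaves R, σ.pts ⊆ T.pts :=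
    fun σ hσ => QuadTree.pts_subset_of_mem_leaves hσ.1
  obtain ⟨hH₂le, hH₂adj⟩ := hH₂.sup_spec
  have hlocal : ∀ u v, H₂.Adj u v → ∃ σ ∈ T.nonemptyLeaves R, u ∈ σ.pts ∧ v ∈ σ.pts := by
    intro u v huv
    obtain ⟨σ, hσ, Hσ, hr, hadj⟩ := hH₂adj u v huv
    exact ⟨σ, hσ, (hr.spec ht.le).1 u v hadj⟩
  obtain ⟨hWwalk, hWadj, E₂, hE₂, hE₂card⟩ := hW.spec (ht.trans_le htt')
  have hSP : S ⊆ T.pts := by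
    intro p hp
    obtain ⟨σ, hσ, rfl⟩ : p ∈ leader '' T.nonemptyLeaves R := hS ▸ Finset.mem_coe.2 hp
    exact hsub σ hσ (hleader σ hσ).1
  have hbase : IsBaseGraph t t' T R leader (H₂ ⊔ W) := by
    refine ⟨fun σ hσ => (hleader σ hσ).1, fun σ hσ u hu v hv => ?_, fun σ hσ τ hτ => ?_⟩
    · obtain ⟨Hσ, hr, hle⟩ := hH₂le σ hσ
      exact ((hr.spec ht.le).2 u hu v hv).mono_graph (hle.trans le_sup_left)
    · have hmem : ∀ σ ∈ T.nonemptyLeaves R, leader σ ∈ S := fun σ hσ =>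
        Finset.mem_coe.1 (hS ▸ Set.mem_image_of_mem _ hσ)
      exact (hWwalk _ (hmem σ hσ) _ (hmem τ hτ)).mono_graph le_sup_right
  have hext₄ : IsGreedyExtension t T.pts (H₂ ⊔ W) s₄.graph := by
    refine h₄.isGreedyExtension SpannerState.graph fun σ hσ s s' h => ?_
    refine h.isGreedyExtension SpannerState.graph fun τ hτ s s' h => ?_
    exact h.isGreedyExtension GreedyMerge.isGreedyExtension (hsub σ hσ) (hsub τ hτ.1)
  have hext₅ : IsGreedyExtension t T.pts s₄.graph s₅.graph := by
    refine h₅.isGreedyExtension SpannerState.graph fun i _ s s' h => ?_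
    refine h.isGreedyExtension SpannerState.graph fun σ hσ s s' h => ?_
    refine h.isGreedyExtension SpannerState.graph fun τ hτ s s' h => ?_
    exact h.isGreedyExtension GreedyMergeLight.isGreedyExtension (hsub σ hσ) (hsub τ hτ.1)
  obtain ⟨ι, Λ, Lab, hΛ, hLab, hLab'⟩ := hC k T R leader (H₂ ⊔ W) hT hR hbase
  obtain ⟨F, hF, hFcard, hFP⟩ := IsGreedyExtension.exists_finset
    (Relation.ReflTransGen.trans hext₄ hext₅) Λ Lab hLab hLab'
  obtain ⟨E₁, hE₁, hE₁card⟩ := exists_finset_of_adj_leaf hT hlocal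
  refine ⟨fun u v huv => ?_, ?_⟩
  · rcases hF ((SimpleGraph.mem_edgeSet _).2 huv) with (h | h) | h
    · obtain ⟨σ, hσ, hu, hv⟩ := hlocal u v h
      exact ⟨hsub σ hσ hu, hsub σ hσ hv⟩
    · exact (hWadj u v h).imp (fun h => hSP h) fun h => hSP h
    · exact hFP u v h
  · have hsubset : s₅.graph.edgeSet ⊆ ((E₁ ∪ E₂ ∪ F : Finset (Sym2 Plane)) : Set (Sym2 Plane)) := by
      refine hF.trans ?_
      rw [SimpleGraph.edgeSet_sup, Finset.coe_union, Finset.coe_union]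
      exact Set.union_subset_union_left _ (Set.union_subset_union hE₁ hE₂)
    refine (Set.encard_le_encard hsubset).trans ?_
    rw [Set.encard_coe_eq_coe_finsetCard, Nat.cast_le]
    calc (E₁ ∪ E₂ ∪ F).card ≤ E₁.card + E₂.card + F.card :=
          (Finset.card_union_le _ _).trans (Nat.add_le_add_right (Finset.card_union_le _ _) _)
      _ ≤ k * T.pts.card + wspdConst (4 * (t' + 1) / (t' - 1)) * T.pts.card + C * T.pts.card :=
          Nat.add_le_add (Nat.add_le_add hE₁card
            (hE₂card.trans (Nat.mul_le_mul_left _ (Finset.card_le_card hSP)))) (hFcard.trans hΛ)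
      _ = _ := by ring
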